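/- Let $d\ge 1$ be an integer, let $\mu<0$ and put $\nu=\frac12\sqrt{1-4\mu}$, so that $\mathrm{Re}\,\nu=\nu>1/2$. For $t_0\ge 0$ and $(v_0,v_1)\in H^1(\mathbb{R}^d)\times L^2(\mathbb{R}^d)$ (complex valued), let $v$ be the solution of the Klein--Gordon equation with scale-invariant mass $$\partial_t^2 v-\Delta v+\frac{\mu}{(1+t)^2}v=0\quad\text{in }(t_0,\infty)\times\mathbb{R}^d,\qquad (v(t_0),\partial_t v(t_0))=(v_0,v_1),$$ that is, $v\in C([t_0,\infty);H^1(\mathbb{R}^d))\cap C^1([t_0,\infty);L^2(\mathbb{R}^d))$ attains the data and satisfies the equation in the sense of distributions on $(t_0,\infty)\times\mathbb{R}^d$. Then the following estimates hold. (i) For every $t_0\ge 0$ there is a constant $C=C(d,\mu,t_0)>0$, independent of $t$ and of the data, such that for all $t\ge t_0$ $$\|v(t)\|_{\dot H^1}+\|\partial_t v(t)\|_{L^2}\le C\,(1+t)^{-\frac12+\mathrm{Re}\,\nu}\bigl(\|v_0\|_{H^1}+\|v_1\|_{L^2}\bigr).$$ (ii) There is a constant $C=C(d,\mu)>0$, independent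 of $t_0$, $t$ and of the data, such that for all $t\ge t_0\ge 0$ $$\|v(t)\|_{L^2}\le C\,(1+t)^{\frac12+\mathrm{Re}\,\nu}(1+t_0)^{\frac12-\mathrm{Re}\,\nu}\bigl(\|v_0\|_{L^2}+\|v_1\|_{L^2}\bigr).$$ -/

import Mathlib

open MeasureTheory Set Filter Topology
open scoped ENNReal FourierTransform Laplacian

noncomputable section

/-- The complex Hilbert space `L²(ℝᵈ)`. -/
abbrev L2Space (d : ℕ) : Type :=
  Lp ℂ 2 (volume : Measure (EuclideanSpace ℝ (Fin d)))

/-- The homogeneous Sobolev norm `‖f‖_{Ḣ¹} = ‖∇f‖_{L²} = ‖|2πξ| 𝓕f(ξ)‖_{L²}`, with values in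
`[0, ∞]`. Mathlib's Fourier transform has the kernel `exp (-2πi x·ξ)`, whence the factor `2π`. -/
def hDotOneNorm {d : ℕ} (f : L2Space d) : ℝ≥0∞ :=
  eLpNorm (fun ξ : EuclideanSpace ℝ (Fin d) =>
    (2 * Real.pi * ‖ξ‖) • (𝓕 f : L2Space d) ξ) 2 volume

/-- The Sobolev norm `‖f‖_{H¹} = ‖(1 + |2πξ|²)^{1/2} 𝓕f(ξ)‖_{L²}`, with values in `[0, ∞]`.
An `f ∈ L²` belongs to `H¹(ℝᵈ)` exactly if this is finite. -/
def hOneNorm {d : ℕ} (f : L2Space d) : ℝ≥0∞ :=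
  eLpNorm (fun ξ : EuclideanSpace ℝ (Fin d) =>
    Real.sqrt (1 + (2 * Real.pi * ‖ξ‖) ^ 2) • (𝓕 f : L2Space d) ξ) 2 volume

/-- The index `ν` attached to the mass parameter `μ`: `ν = √(1 - 4μ) / 2` if `μ ≤ 1/4` and
`ν = i √(4μ - 1) / 2` if `μ > 1/4`. -/
def kgIndex (μ : ℝ) : ℂ :=
  if μ ≤ 1 / 4 then ((Real.sqrt (1 - 4 * μ) / 2 : ℝ) : ℂ)
  else Complex.I * ((Real.sqrt (4 * μ - 1) / 2 : ℝ) : ℂ)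

/-- `v` is the solution, with time derivative `vt`, of the Klein-Gordon equation with
scale-invariant mass
`∂ₜ²v - Δv + μ (1 + t)⁻² v = 0` on `(t₀, ∞) × ℝᵈ`, `(v(t₀), ∂ₜv(t₀)) = (v₀, v₁)`:
`v ∈ C([t₀, ∞); H¹) ∩ C¹([t₀, ∞); L²)`, the data are attained, and the equation holds in the sense
of distributions on `(t₀, ∞) × ℝᵈ`. Values of `v` and `vt` at times before `t₀` play no role. -/
structure IsKGSolution {d : ℕ} (μ t₀ : ℝ) (v₀ v₁ : L2Space d) (v vt : ℝ → L2Space d) :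
    Prop where
  mem_hOne : ∀ t, t₀ ≤ t → hOneNorm (v t) < ⊤
  continuous_hOne : ∀ t, t₀ ≤ t →
    Tendsto (fun s => hOneNorm (v s - v t)) (𝓝[Ici t₀] t) (𝓝 0)
  hasDeriv : ∀ t, t₀ ≤ t → HasDerivWithinAt v (vt t) (Ici t₀) t
  continuous_deriv : ContinuousOn vt (Ici t₀)
  initial : v t₀ = v₀
  initial_deriv : vt t₀ = v₁
  equation : ∀ φ : ℝ × EuclideanSpace ℝ (Fin d) → ℂ,
    ContDiff ℝ (⊤ : ℕ∞) φ → HasCompactSupport φ → tsupport φ ⊆ Ioi t₀ ×ˢ univ →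
    ∫ t in Ioi t₀, ∫ x, v t x *
      (iteratedDeriv 2 (fun s : ℝ => φ (s, x)) t
        - Δ (fun y : EuclideanSpace ℝ (Fin d) => φ (t, y)) x
        + ((μ / (1 + t) ^ 2 : ℝ) : ℂ) * φ (t, x)) = 0

end

/-! Put `p = 1/2 + ν`, so that `p > 1` and `p (p - 1) = -μ`. On the Fourier side the equation reads
`u'' + M u = p (p - 1) (1 + t)⁻² u`, with `M = N²` and `N` multiplication by `|2πξ|`. The power `(1
+ t)^p` solves it for `M = 0`. The weighted quantities `z = (1 + t)^(1-p) u' + (p - 1) (1 + t)^(-p)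
u` and `y = (1 + t)^(1-p) N u` satisfy `(‖z‖² + ‖y‖²)' = -4 (p - 1) (1 + t)^(1-2p) ‖N u‖² ≤ 0`. This
one monotonicity (`IsModeSolution.norm_sq_add_norm_sq_le`) carries everything: the bound on `y`
controls `N u`, and integrating `z = (1 + t)^(2-2p) ((1 + t)^(p-1) u)'` controls `u` and then `u'`.

For (i) this is applied to `v` itself. For (ii) no derivative of the data is available, so
frequencies are split at `|2πξ| = (1 + t₀)⁻¹`. Below it, `N` costs only `(1 + t₀)⁻¹`, and the bound
on `u` suffices. Above it, the bound on `N u` is applied to `u = |2πξ|⁻¹ 𝓕v`, so that `N u = 𝓕v`.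

The distributional equation must first become an ordinary differential equation. Testing with
products `χ(t) ψ(x)` and taking the Fourier transform in `x` gives a weak equation in `t`; a
frequency cutoff makes `M` bounded, and du Bois-Reymond makes the second derivative classical
(`IsKGSolution.isModeSolution`). All bounds are uniform in the cutoff, which Fatou's lemma then
removes. -/

noncomputable section

/-! ### Weighted energy estimate for an abstract second-order equation -/

section Energy

variable {H : Type*} [NormedAddCommGroup H] [InnerProductSpace ℝ H]

/-- `u` solves `u'' = -M u + p (p - 1) (1 + t)⁻² u` on `[t₀, ∞)` and `u' = u₁`. -/
structure IsModeSolution (p t₀ : ℝ) (M : H →L[ℝ] H) (u u₁ : ℝ → H) : Prop where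
  hasDeriv : ∀ t, t₀ ≤ t → HasDerivWithinAt u (u₁ t) (Ici t₀) t
  hasDeriv₂ : ∀ t, t₀ ≤ t →
    HasDerivWithinAt u₁ (-(M (u t)) + (p * (p - 1) / (1 + t) ^ 2) • u t) (Ici t₀) t

/-- The size of the initial data in the energy norm. -/
def modeData (p t₀ : ℝ) (N : H →L[ℝ] H) (u u₁ : ℝ → H) : ℝ :=
  (1 + t₀) ^ (-p) *
    ((1 + t₀) * ‖u₁ t₀‖ + (p - 1) * ‖u t₀‖ + (1 + t₀) * ‖N (u t₀)‖)

variable {p t₀ : ℝ} {M N : H →L[ℝ] H} {u u₁ : ℝ → H}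

lemma modeData_nonneg (hp : 1 < p) (ht₀ : 0 ≤ t₀) : 0 ≤ modeData p t₀ N u u₁ := by
  unfold modeData
  have : 0 < p - 1 := by linarith
  positivity

lemma hasDerivWithinAt_one_add_rpow (q : ℝ) {t : ℝ} (ht : 0 ≤ t) (s : Set ℝ) :
    HasDerivWithinAt (fun t : ℝ => (1 + t) ^ q) (q * (1 + t) ^ (q - 1)) s t := by
  have h : HasDerivAt (fun t : ℝ => 1 + t) 1 t := (hasDerivAt_id t).const_add 1
  have := (h.rpow_const (p := q) (Or.inl (by linarith : (1 + t) ≠ 0))).hasDerivWithinAt (s := s)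
  simpa using this

/-- The momentum-type quantity `(1 + t)^(-p) ((1 + t) u' + (p - 1) u)` has derivative
`-(1 + t)^(1 - p) M u`. -/
lemma IsModeSolution.hasDerivWithinAt_momentum (h : IsModeSolution p t₀ M u u₁) (ht₀ : 0 ≤ t₀)
    {t : ℝ} (ht : t₀ ≤ t) :
    HasDerivWithinAt (fun t => (1 + t) ^ (1 - p) • u₁ t + ((p - 1) * (1 + t) ^ (-p)) • u t)
      (-((1 + t) ^ (1 - p) • M (u t))) (Ici t₀) t := by
  have hw : 0 < 1 + t := by linarith
  have h1 := (hasDerivWithinAt_one_add_rpow (1 - p) (ht₀.trans ht) (Ici t₀)).fun_smul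
    (h.hasDeriv₂ t ht)
  have h2 := ((hasDerivWithinAt_one_add_rpow (-p) (ht₀.trans ht) (Ici t₀)).const_mul
    (p - 1)).fun_smul (h.hasDeriv t ht)
  convert h1.fun_add h2 using 1
  have e1 : (1 + t) ^ (1 - p) = (1 + t) ^ (-p - 1) * (1 + t) ^ 2 := by
    rw [← Real.rpow_natCast, ← Real.rpow_add hw]; congr 1; push_cast; ring
  have e2 : (1 + t) ^ (-p) = (1 + t) ^ (-p - 1) * (1 + t) := by
    rw [← Real.rpow_add_one hw.ne']; congr 1; ring
  have e3 : (1 + t) ^ (1 - p - 1) = (1 + t) ^ (-p) := by congr 1; ring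
  rw [e3, e2, e1]
  match_scalars <;> field_simp <;> ring

lemma IsModeSolution.hasDerivWithinAt_weighted (h : IsModeSolution p t₀ M u u₁) (ht₀ : 0 ≤ t₀)
    {t : ℝ} (ht : t₀ ≤ t) :
    HasDerivWithinAt (fun t => (1 + t) ^ (1 - p) • N (u t))
      ((1 + t) ^ (1 - p) • N (u₁ t) + ((1 - p) * (1 + t) ^ (-p)) • N (u t)) (Ici t₀) t := by
  have h1 := (hasDerivWithinAt_one_add_rpow (1 - p) (ht₀.trans ht) (Ici t₀)).fun_smul
    (N.hasFDerivAt.comp_hasDerivWithinAt t (h.hasDeriv t ht))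
  refine h1.congr_deriv ?_
  rw [show 1 - p - 1 = -p by ring]
  rfl

/-- The cross terms `⟪u', M u⟫` and `⟪N u', N u⟫` cancel by `hNM`. The terms from the weight both
have the sign of `1 - p`, so the energy decreases. -/
lemma IsModeSolution.norm_sq_add_norm_sq_le (h : IsModeSolution p t₀ M u u₁) (hp : 1 < p)
    (ht₀ : 0 ≤ t₀) (hNM : ∀ x y, inner ℝ (N x) (N y) = inner ℝ (M x) y) {t : ℝ} (ht : t₀ ≤ t) :
    ‖(1 + t) ^ (1 - p) • u₁ t + ((p - 1) * (1 + t) ^ (-p)) • u t‖ ^ 2 +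
      ‖(1 + t) ^ (1 - p) • N (u t)‖ ^ 2 ≤ modeData p t₀ N u u₁ ^ 2 := by
  set z := fun t => (1 + t) ^ (1 - p) • u₁ t + ((p - 1) * (1 + t) ^ (-p)) • u t with hz
  set y := fun t => (1 + t) ^ (1 - p) • N (u t) with hy
  have hd : ∀ t, t₀ ≤ t → HasDerivWithinAt (fun t => ‖z t‖ ^ 2 + ‖y t‖ ^ 2)
      (-(4 * (p - 1) * ((1 + t) ^ (1 - p) * (1 + t) ^ (-p)) * ‖N (u t)‖ ^ 2)) (Ici t₀) t := by
    intro t ht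
    have h1 := (h.hasDerivWithinAt_momentum ht₀ ht).norm_sq
    have h2 := (h.hasDerivWithinAt_weighted (N := N) ht₀ ht).norm_sq
    refine (h1.fun_add h2).congr_deriv ?_
    simp only [inner_add_left, inner_add_right, inner_smul_left, inner_smul_right, inner_neg_right,
      conj_trivial, real_inner_self_eq_norm_sq]
    rw [real_inner_comm (M (u t)) (u t), real_inner_comm (M (u t)) (u₁ t), ← hNM, ← hNM,
      real_inner_self_eq_norm_sq]
    ring
  have hanti : AntitoneOn (fun t => ‖z t‖ ^ 2 + ‖y t‖ ^ 2) (Ici t₀) := by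
    refine antitoneOn_of_hasDerivWithinAt_nonpos (convex_Ici t₀)
      (fun t ht => (hd t ht).continuousWithinAt)
      (fun t ht => (hd t (interior_subset ht)).mono interior_subset) (fun t ht => ?_)
    have ht' : t₀ ≤ t := interior_subset ht
    have : 0 ≤ 1 + t := by linarith
    have : 0 ≤ p - 1 := by linarith
    rw [neg_nonpos]
    positivity
  refine (hanti self_mem_Ici ht ht).trans ?_
  have hw : 0 < 1 + t₀ := by linarith
  have hp' : 0 < p - 1 := by linarith
  have e : (1 + t₀) ^ (1 - p) = (1 + t₀) ^ (-p) * (1 + t₀) := by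
    rw [← Real.rpow_add_one hw.ne']; congr 1; ring
  have hz0 : ‖z t₀‖ ≤ (1 + t₀) ^ (-p) * ((1 + t₀) * ‖u₁ t₀‖ + (p - 1) * ‖u t₀‖) := by
    refine (norm_add_le _ _).trans_eq ?_
    rw [norm_smul_of_nonneg (by positivity), norm_smul_of_nonneg (by positivity), e]
    ring
  have hy0 : ‖y t₀‖ = (1 + t₀) ^ (-p) * ((1 + t₀) * ‖N (u t₀)‖) := by
    rw [hy]
    simp only
    rw [norm_smul_of_nonneg (by positivity), e]
    ring
  have hsum : ‖z t₀‖ + ‖y t₀‖ ≤ modeData p t₀ N u u₁ := by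
    rw [hy0]; unfold modeData; linarith
  calc ‖z t₀‖ ^ 2 + ‖y t₀‖ ^ 2 ≤ (‖z t₀‖ + ‖y t₀‖) ^ 2 := by
        nlinarith [norm_nonneg (z t₀), norm_nonneg (y t₀)]
    _ ≤ _ := by gcongr

lemma IsModeSolution.norm_map_le (h : IsModeSolution p t₀ M u u₁) (hp : 1 < p)
    (ht₀ : 0 ≤ t₀) (hNM : ∀ x y, inner ℝ (N x) (N y) = inner ℝ (M x) y) {t : ℝ} (ht : t₀ ≤ t) :
    ‖N (u t)‖ ≤ (1 + t) ^ (p - 1) * modeData p t₀ N u u₁ := by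
  have hw : 0 < 1 + t := by linarith
  have h1 := h.norm_sq_add_norm_sq_le hp ht₀ hNM ht
  have h2 : ‖(1 + t) ^ (1 - p) • N (u t)‖ ≤ modeData p t₀ N u u₁ :=
    (pow_le_pow_iff_left₀ (norm_nonneg _) (modeData_nonneg hp ht₀) two_ne_zero).1
      (le_trans (le_add_of_nonneg_left (sq_nonneg _)) h1)
  rw [norm_smul_of_nonneg (by positivity)] at h2
  calc ‖N (u t)‖ = (1 + t) ^ (p - 1) * ((1 + t) ^ (1 - p) * ‖N (u t)‖) := by
        rw [← mul_assoc, ← Real.rpow_add hw]; simp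
    _ ≤ _ := by gcongr

lemma IsModeSolution.norm_momentum_le (h : IsModeSolution p t₀ M u u₁) (hp : 1 < p)
    (ht₀ : 0 ≤ t₀) (hNM : ∀ x y, inner ℝ (N x) (N y) = inner ℝ (M x) y) {t : ℝ} (ht : t₀ ≤ t) :
    ‖(1 + t) ^ (1 - p) • u₁ t + ((p - 1) * (1 + t) ^ (-p)) • u t‖ ≤ modeData p t₀ N u u₁ :=
  (pow_le_pow_iff_left₀ (norm_nonneg _) (modeData_nonneg hp ht₀) two_ne_zero).1
    (le_trans (le_add_of_nonneg_right (sq_nonneg _)) (h.norm_sq_add_norm_sq_le hp ht₀ hNM ht))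

/-- The momentum is `(1 + s)^(2-2p)` times the derivative of `(1 + s)^(p-1) u`, so its uniform bound
integrates to growth of order `(1 + s)^(2p-1)`. -/
lemma IsModeSolution.norm_le (h : IsModeSolution p t₀ M u u₁) (hp : 1 < p)
    (ht₀ : 0 ≤ t₀) (hNM : ∀ x y, inner ℝ (N x) (N y) = inner ℝ (M x) y) {t : ℝ} (ht : t₀ ≤ t) :
    ‖u t‖ ≤ (1 + t) ^ p * ((1 + t₀) ^ (-p) * ‖u t₀‖ + modeData p t₀ N u u₁) := by
  set D := modeData p t₀ N u u₁ with hD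
  have hD0 : 0 ≤ D := modeData_nonneg hp ht₀
  have hw : 0 < 1 + t := by linarith
  have hw₀ : 0 < 1 + t₀ := by linarith
  have hder : ∀ s, t₀ ≤ s → HasDerivWithinAt (fun s => (1 + s) ^ (p - 1) • u s)
      ((1 + s) ^ (2 * p - 2) •
        ((1 + s) ^ (1 - p) • u₁ s + ((p - 1) * (1 + s) ^ (-p)) • u s)) (Ici t₀) s := by
    intro s hs
    have hws : 0 < 1 + s := by linarith
    convert (hasDerivWithinAt_one_add_rpow (p - 1) (ht₀.trans hs) (Ici t₀)).fun_smul
      (h.hasDeriv s hs) using 1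
    rw [smul_add, smul_smul, smul_smul, ← Real.rpow_add hws, mul_left_comm, ← Real.rpow_add hws,
      show 2 * p - 2 + (1 - p) = p - 1 by ring, show 2 * p - 2 + -p = p - 1 - 1 by ring]
  have key := image_norm_le_of_norm_deriv_right_le_deriv_boundary'
    (f := fun s => (1 + s) ^ (p - 1) • u s)
    (f' := fun s => (1 + s) ^ (2 * p - 2) •
        ((1 + s) ^ (1 - p) • u₁ s + ((p - 1) * (1 + s) ^ (-p)) • u s)) (a := t₀) (b := t)
    (fun s hs => ((hder s hs.1).continuousWithinAt).mono Icc_subset_Ici_self)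
    (fun s hs => (hder s hs.1).mono (Ici_subset_Ici.2 hs.1))
    -- The exact primitive of `(1 + s)^(2p-2)` carries a factor `1 / (2p - 1)`; it is dropped, since
    -- `2p - 1 ≥ 1`.
    (B := fun s => (1 + t₀) ^ (p - 1) * ‖u t₀‖ +
      D * ((1 + s) ^ (2 * p - 1) - (1 + t₀) ^ (2 * p - 1)))
    (B' := fun s => D * ((2 * p - 1) * (1 + s) ^ (2 * p - 1 - 1)))
    (by simp only [sub_self, mul_zero, add_zero]; rw [norm_smul_of_nonneg (by positivity)])
    (fun s hs => (((hasDerivWithinAt_one_add_rpow (2 * p - 1) (ht₀.trans hs.1)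
      (Icc t₀ t)).sub_const _).const_mul D |>.const_add _).continuousWithinAt)
    (fun s hs => ((hasDerivWithinAt_one_add_rpow (2 * p - 1) (ht₀.trans hs.1)
      (Ici s)).sub_const _).const_mul D |>.const_add _)
    (fun s hs => by
      have hws : 0 < 1 + s := by linarith [hs.1]
      rw [norm_smul_of_nonneg (by positivity), show 2 * p - 1 - 1 = 2 * p - 2 by ring]
      have h1 := h.norm_momentum_le hp ht₀ hNM hs.1
      calc _ ≤ (1 + s) ^ (2 * p - 2) * D := by gcongr
        _ = D * (1 * (1 + s) ^ (2 * p - 2)) := by ring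
        _ ≤ _ := by gcongr; linarith)
    (right_mem_Icc.2 ht)
  rw [norm_smul_of_nonneg (by positivity)] at key
  have e1 : (1 + t₀) ^ (p - 1) ≤ (1 + t) ^ (2 * p - 1) * (1 + t₀) ^ (-p) := by
    have : (1 + t₀) ^ (p - 1) = (1 + t₀) ^ (2 * p - 1) * (1 + t₀) ^ (-p) := by
      rw [← Real.rpow_add hw₀]; congr 1; ring
    rw [this]
    gcongr
    linarith
  have e2 : (1 + t) ^ (2 * p - 1) = (1 + t) ^ (p - 1) * (1 + t) ^ p := by
    rw [← Real.rpow_add hw]; congr 1; ring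
  have h3 : (1 + t) ^ (p - 1) * ‖u t‖ ≤
      (1 + t) ^ (p - 1) * ((1 + t) ^ p * ((1 + t₀) ^ (-p) * ‖u t₀‖ + D)) := by
    calc _ ≤ _ := key
      _ ≤ (1 + t) ^ (2 * p - 1) * (1 + t₀) ^ (-p) * ‖u t₀‖ + D * ((1 + t) ^ (2 * p - 1) - 0) := by
        gcongr
        positivity
      _ = _ := by rw [e2]; ring
  exact le_of_mul_le_mul_left h3 (by positivity)

/-- The momentum and `u` are both controlled, so `u'` is recovered by solving the momentum for it.
-/
lemma IsModeSolution.norm_deriv_le (h : IsModeSolution p t₀ M u u₁) (hp : 1 < p)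
    (ht₀ : 0 ≤ t₀) (hNM : ∀ x y, inner ℝ (N x) (N y) = inner ℝ (M x) y) {t : ℝ} (ht : t₀ ≤ t) :
    ‖u₁ t‖ ≤ (1 + t) ^ (p - 1) *
      (p * modeData p t₀ N u u₁ + (p - 1) * ((1 + t₀) ^ (-p) * ‖u t₀‖)) := by
  have hw : 0 < 1 + t := by linarith
  have hp' : 0 < p - 1 := by linarith
  set D := modeData p t₀ N u u₁ with hD
  have h1 := h.norm_momentum_le hp ht₀ hNM ht
  have h2 := h.norm_le hp ht₀ hNM ht
  have e1 : (1 + t) ^ (p - 1) * (1 + t) ^ (1 - p) = 1 := by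
    rw [← Real.rpow_add hw]; simp
  have e2 : (1 + t) ^ (-p) * (1 + t) ^ p = 1 := by
    rw [← Real.rpow_add hw]; simp
  have e : u₁ t = (1 + t) ^ (p - 1) • (((1 + t) ^ (1 - p) • u₁ t +
      ((p - 1) * (1 + t) ^ (-p)) • u t) - ((p - 1) * (1 + t) ^ (-p)) • u t) := by
    rw [add_sub_cancel_right, smul_smul, e1, one_smul]
  rw [e, norm_smul_of_nonneg (by positivity)]
  gcongr
  refine (norm_sub_le _ _).trans ?_
  rw [norm_smul_of_nonneg (by positivity)]
  have h3 : (p - 1) * (1 + t) ^ (-p) * ‖u t‖ ≤ (p - 1) * ((1 + t₀) ^ (-p) * ‖u t₀‖ + D) := by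
    calc _ ≤ (p - 1) * (1 + t) ^ (-p) * ((1 + t) ^ p * ((1 + t₀) ^ (-p) * ‖u t₀‖ + D)) := by
          gcongr
      _ = (p - 1) * ((1 + t) ^ (-p) * (1 + t) ^ p) * ((1 + t₀) ^ (-p) * ‖u t₀‖ + D) := by ring
      _ = _ := by rw [e2, mul_one]
  linarith

end Energy

/-! ### Test functions on a half-line and the lemma of du Bois-Reymond -/

section DuBoisReymond

variable {F : Type*} [NormedAddCommGroup F] [NormedSpace ℝ F] {a : ℝ}

lemma setIntegral_Ioi_eq_integral_of_tsupport_subset {χ : ℝ → ℝ} {g : ℝ → F}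
    (hχ : tsupport χ ⊆ Ioi a) :
    ∫ t in Ioi a, χ t • g t = ∫ t, χ t • g t := by
  refine setIntegral_eq_integral_of_forall_compl_eq_zero fun t ht => ?_
  rw [image_eq_zero_of_notMem_tsupport fun h => ht (hχ h), zero_smul]

/-- A cutoff supported in `s` times a function continuous on `s` is continuous. -/
lemma continuous_smul_of_tsupport_subset {χ : ℝ → ℝ} {g : ℝ → F} {s : Set ℝ} (hs : IsOpen s)
    (hχ : Continuous χ) (hsupp : tsupport χ ⊆ s) (hg : ContinuousOn g s) :
    Continuous fun t => χ t • g t := by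
  refine continuous_iff_continuousAt.2 fun t => ?_
  by_cases ht : t ∈ s
  · exact hχ.continuousAt.smul (hg.continuousAt (hs.mem_nhds ht))
  · have h0 : ∀ᶠ x in 𝓝 t, χ x = 0 := by
      filter_upwards [(isClosed_tsupport χ).isOpen_compl.mem_nhds fun h => ht (hsupp h)] with x hx
      exact image_eq_zero_of_notMem_tsupport hx
    refine ContinuousAt.congr (f := fun _ => (0 : F)) continuousAt_const ?_
    filter_upwards [h0] with x hx
    rw [hx, zero_smul]

lemma integrable_smul_of_tsupport_subset {χ : ℝ → ℝ} {g : ℝ → F} {s : Set ℝ} (hs : IsOpen s)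
    (hχ : Continuous χ) (hc : HasCompactSupport χ) (hsupp : tsupport χ ⊆ s)
    (hg : ContinuousOn g s) : Integrable fun t => χ t • g t :=
  (continuous_smul_of_tsupport_subset hs hχ hsupp hg).integrable_of_hasCompactSupport
    (hc.smul_right (f' := g))

/-- Integration by parts against a test function on a half-line. -/
lemma integral_deriv_smul_eq_neg [CompleteSpace F] {χ : ℝ → ℝ} {g g' : ℝ → F}
    (hχ : ContDiff ℝ 1 χ)
    (hc : HasCompactSupport χ) (hsupp : tsupport χ ⊆ Ioi a)
    (hg : ∀ t ∈ Ioi a, HasDerivAt g (g' t) t) (hg' : ContinuousOn g' (Ioi a)) :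
    ∫ t, deriv χ t • g t = -∫ t, χ t • g' t := by
  have hgc : ContinuousOn g (Ioi a) := fun t ht => (hg t ht).continuousAt.continuousWithinAt
  have hsupp' : tsupport (deriv χ) ⊆ Ioi a := tsupport_deriv_subset.trans hsupp
  have hi1 := integrable_smul_of_tsupport_subset isOpen_Ioi hχ.continuous hc hsupp hg'
  have hi2 := integrable_smul_of_tsupport_subset isOpen_Ioi (hχ.continuous_deriv le_rfl)
    hc.deriv hsupp' hgc
  have hi3 := integrable_smul_of_tsupport_subset isOpen_Ioi hχ.continuous hc hsupp hgc
  -- Outside `Ioi a` nothing is known about `g`, but there the product vanishes in a neighbourhood.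
  have hd : ∀ t, HasDerivAt (fun t => χ t • g t) (χ t • g' t + deriv χ t • g t) t := by
    intro t
    by_cases ht : t ∈ Ioi a
    · exact (hχ.differentiable one_ne_zero t).hasDerivAt.smul (hg t ht)
    · have hnt : t ∉ tsupport χ := fun h => ht (hsupp h)
      rw [image_eq_zero_of_notMem_tsupport hnt,
        image_eq_zero_of_notMem_tsupport (f := deriv χ) fun h => ht (hsupp' h),
        zero_smul, zero_smul, add_zero]
      refine (hasDerivAt_const t (0 : F)).congr_of_eventuallyEq ?_
      filter_upwards [(isClosed_tsupport χ).isOpen_compl.mem_nhds hnt] with x hx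
      rw [image_eq_zero_of_notMem_tsupport hx, zero_smul]
  have := integral_eq_zero_of_hasDerivAt_of_integrable hd (hi1.add hi2) hi3
  rw [integral_add hi1 hi2] at this
  exact eq_neg_of_add_eq_zero_right this

/-- A compactly supported smooth function with vanishing integral is the derivative of one. -/
lemma exists_contDiff_deriv_eq_of_integral_eq_zero {η : ℝ → ℝ} (hη : ContDiff ℝ (⊤ : ℕ∞) η)
    (hc : HasCompactSupport η) (hsupp : tsupport η ⊆ Ioi a) (h0 : ∫ t, η t = 0) :
    ∃ χ : ℝ → ℝ, ContDiff ℝ (⊤ : ℕ∞) χ ∧ HasCompactSupport χ ∧ tsupport χ ⊆ Ioi a ∧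
      deriv χ = η := by
  -- A base point strictly beyond `a` keeps the closed support of the primitive inside `Ioi a`.
  obtain ⟨b, hab, hb⟩ : ∃ b, a < b ∧ tsupport η ⊆ Ici b := by
    rcases (tsupport η).eq_empty_or_nonempty with he | hne
    · exact ⟨a + 1, by linarith, by simp [he]⟩
    · obtain ⟨b, hb, hmin⟩ := hc.isCompact.exists_isLeast hne
      exact ⟨b, hsupp hb, hmin⟩
  obtain ⟨c, hc'⟩ := hc.isCompact.bddAbove
  have hvan : ∀ t, t < b → η t = 0 := fun t ht =>
    image_eq_zero_of_notMem_tsupport fun h => (not_le.2 ht) (hb h)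
  have hvan' : ∀ t, c < t → η t = 0 := fun t ht =>
    image_eq_zero_of_notMem_tsupport fun h => (not_le.2 ht) (hc' h)
  have hi : Integrable η := hη.continuous.integrable_of_hasCompactSupport hc
  set χ : ℝ → ℝ := fun t => ∫ s in b..t, η s with hχ
  have hderiv : ∀ t, HasDerivAt χ (η t) t := fun t =>
    intervalIntegral.integral_hasDerivAt_right (hη.continuous.intervalIntegrable _ _)
      (hη.continuous.stronglyMeasurableAtFilter _ _) hη.continuous.continuousAt
  have hd : deriv χ = η := funext fun t => (hderiv t).deriv
  have hleft : ∀ t, t ≤ b → χ t = 0 := fun t ht => by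
    rw [hχ]
    simp only
    rw [intervalIntegral.integral_symm, intervalIntegral.integral_of_le ht,
      ← integral_Ico_eq_integral_Ioc,
      setIntegral_eq_zero_of_forall_eq_zero fun s hs => hvan s hs.2, neg_zero]
  have hright : ∀ t, max b c ≤ t → χ t = 0 := fun t ht => by
    have hbt : b ≤ t := (le_max_left _ _).trans ht
    rw [hχ]
    simp only
    rw [intervalIntegral.integral_of_le hbt, ← integral_Icc_eq_integral_Ioc,
      setIntegral_eq_integral_of_forall_compl_eq_zero, h0]
    intro s hs
    by_cases hsb : s < b
    · exact hvan s hsb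
    · refine hvan' s ((le_max_right _ _).trans_lt (ht.trans_lt ?_))
      by_contra hst
      exact hs ⟨not_lt.1 hsb, not_lt.1 hst⟩
  have hsub : tsupport χ ⊆ Icc b (max b c) := by
    refine closure_minimal (fun t ht => ?_) isClosed_Icc
    refine ⟨le_of_not_ge fun h => ht (hleft t h), le_of_not_ge fun h => ht (hright t h)⟩
  refine ⟨χ, ?_, HasCompactSupport.of_support_subset_isCompact isCompact_Icc
    ((subset_tsupport χ).trans hsub), hsub.trans fun t ht => hab.trans_le ht.1, hd⟩
  exact contDiff_infty_iff_deriv.2 ⟨fun t => (hderiv t).differentiableAt, hd ▸ hη⟩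

/-- The lemma of du Bois-Reymond on a half-line. -/
lemma exists_eq_const_of_integral_deriv_smul_eq_zero [CompleteSpace F] {c : ℝ → F}
    (hc : ContinuousOn c (Ioi a))
    (h : ∀ χ : ℝ → ℝ, ContDiff ℝ (⊤ : ℕ∞) χ → HasCompactSupport χ → tsupport χ ⊆ Ioi a →
      ∫ t, deriv χ t • c t = 0) :
    ∃ c₀ : F, ∀ t ∈ Ioi a, c t = c₀ := by
  -- The support is `[a + 1, a + 3]`, inside `Ioi a`. Subtracting a multiple of this bump gives any
  -- test function integral zero, hence a test primitive; the constant must be the average of `c`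
  -- against the bump.
  let B : ContDiffBump (a + 2) := ⟨1 / 2, 1, by norm_num, by norm_num⟩
  set η₀ : ℝ → ℝ := B.normed volume with hη₀
  have hη₀s : ContDiff ℝ (⊤ : ℕ∞) η₀ := B.contDiff_normed
  have hη₀c : HasCompactSupport η₀ := B.hasCompactSupport_normed
  have hη₀t : tsupport η₀ ⊆ Ioi a := by
    rw [hη₀, B.tsupport_normed_eq]
    intro t ht
    rw [Metric.mem_closedBall, Real.dist_eq, abs_le] at ht
    have : -(1 : ℝ) ≤ t - (a + 2) := ht.1
    rw [mem_Ioi]; linarith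
  have hη₀i : ∫ t, η₀ t = 1 := B.integral_normed
  refine ⟨∫ t, η₀ t • c t, ?_⟩
  set c₀ := ∫ t, η₀ t • c t with hc₀
  have key : ∀ g : ℝ → ℝ, ContDiff ℝ (⊤ : ℕ∞) g → HasCompactSupport g → tsupport g ⊆ Ioi a →
      ∫ t, g t • (c t - c₀) = 0 := by
    intro g hg hgc hgt
    set m := ∫ t, g t with hm
    have hgi : Integrable g := hg.continuous.integrable_of_hasCompactSupport hgc
    have hηi : Integrable η₀ := hη₀s.continuous.integrable_of_hasCompactSupport hη₀c
    obtain ⟨χ, h1, h2, h3, h4⟩ := exists_contDiff_deriv_eq_of_integral_eq_zero (a := a)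
      (η := fun t => g t - m * η₀ t) (hg.sub (contDiff_const.mul hη₀s))
      (hgc.sub hη₀c.mul_left)
      ((tsupport_sub _ _).trans (union_subset hgt ((tsupport_mul_subset_right).trans hη₀t)))
      (by rw [integral_sub hgi (hηi.const_mul m), integral_const_mul, hη₀i, mul_one, sub_self])
    have := h χ h1 h2 h3
    have hi1 := integrable_smul_of_tsupport_subset isOpen_Ioi hg.continuous hgc hgt hc
    have hi2 := integrable_smul_of_tsupport_subset isOpen_Ioi hη₀s.continuous hη₀c hη₀t hc
    rw [h4] at this
    simp only [sub_smul, mul_smul] at this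
    rw [integral_sub hi1 (g := fun t => m • η₀ t • c t) (hi2.smul m), integral_smul] at this
    simp only [smul_sub]
    rw [integral_sub hi1 (hgi.smul_const c₀), integral_smul_const]
    exact this
  have hae := isOpen_Ioi.ae_eq_zero_of_integral_contDiff_smul_eq_zero (μ := volume)
    (f := fun t => c t - c₀) (U := Ioi a)
    ((hc.sub continuousOn_const).locallyIntegrableOn measurableSet_Ioi) key
  have hae' : (fun t => c t) =ᵐ[volume.restrict (Ioi a)] fun _ => c₀ := by
    rw [Filter.EventuallyEq, ae_restrict_iff' measurableSet_Ioi]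
    filter_upwards [hae] with t ht hta
    exact sub_eq_zero.1 (ht hta)
  exact Measure.eqOn_open_of_ae_eq hae' isOpen_Ioi hc continuousOn_const

end DuBoisReymond

/-! ### Density of compactly supported functions in the Schwartz space -/

section SchwartzDensity

open scoped SchwartzMap

variable {E : Type*} [NormedAddCommGroup E] [InnerProductSpace ℝ E]

/-- All derivatives of a smooth compactly supported function minus a constant are bounded. -/
lemma exists_norm_iteratedFDeriv_sub_const_le {η : E → ℝ}
    (hc : HasCompactSupport η) (hη : ContDiff ℝ (⊤ : ℕ∞) η) (b : ℝ) (i : ℕ) :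
    ∃ C : ℝ, 0 ≤ C ∧ ∀ x, ‖iteratedFDeriv ℝ i (fun y => η y - b) x‖ ≤ C := by
  obtain ⟨C, hC⟩ := (hc.iteratedFDeriv (𝕜 := ℝ) i).exists_bound_of_continuous
    (hη.continuous_iteratedFDeriv (m := i) (by exact_mod_cast le_top))
  refine ⟨C + |b|, add_nonneg ((norm_nonneg _).trans (hC 0)) (abs_nonneg b), fun x => ?_⟩
  have hη' : ContDiff ℝ i η := hη.of_le (by exact_mod_cast le_top)
  have : (fun y => η y - b) = η - fun _ => b := rfl
  rw [this, iteratedFDeriv_sub_apply hη'.contDiffAt contDiffAt_const]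
  refine (norm_sub_le _ _).trans (add_le_add (hC x) ?_)
  rcases Nat.eq_zero_or_pos i with rfl | hi
  · simp
  · rw [iteratedFDeriv_const_of_ne hi.ne']
    simp

/-- The Schwartz seminorms of `(η (r x) - 1) ψ`, with `η = 1` on the unit ball, are `O(r)`. -/
lemma exists_pow_mul_norm_iteratedFDeriv_cutoff_le {η : E → ℝ} (hηc : HasCompactSupport η)
    (hηs : ContDiff ℝ (⊤ : ℕ∞) η) (hη : ∀ x, ‖x‖ ≤ 1 → η x = 1) (ψ : 𝓢(E, ℂ)) (k m : ℕ) :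
    ∃ K : ℝ, 0 ≤ K ∧ ∀ r : ℝ, 0 < r → r ≤ 1 → ∀ x,
      ‖x‖ ^ k * ‖iteratedFDeriv ℝ m (fun y => (η (r • y) - 1) • ψ y) x‖ ≤ r * K := by
  choose C hC0 hC using fun i => exists_norm_iteratedFDeriv_sub_const_le hηc hηs 1 i
  have hK0 : 0 ≤ ∑ i ∈ Finset.range (m + 1),
      (m.choose i : ℝ) * C i * SchwartzMap.seminorm ℝ (k + 1) (m - i) ψ :=
    Finset.sum_nonneg fun i _ =>
      mul_nonneg (mul_nonneg (Nat.cast_nonneg _) (hC0 i)) (apply_nonneg _ _)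
  refine ⟨_, hK0, fun r hr0 hr1 x => ?_⟩
  -- The difference vanishes near `x` in the first case. In the other, `1 ≤ r ‖x‖` buys the factor
  -- `r` at the price of one more power of `‖x‖` in the seminorm.
  by_cases hx : r * ‖x‖ < 1
  · have hev : (fun y => (η (r • y) - 1) • ψ y) =ᶠ[𝓝 x] fun _ => 0 := by
      have hopen : IsOpen {y : E | r * ‖y‖ < 1} := isOpen_lt (by fun_prop) continuous_const
      filter_upwards [hopen.mem_nhds hx] with y hy
      rw [hη _ (by rw [norm_smul_of_nonneg hr0.le]; exact le_of_lt hy), sub_self, zero_smul]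
    rw [(hev.iteratedFDeriv ℝ m).eq_of_nhds]
    simp only [iteratedFDeriv_fun_zero, Pi.zero_apply, norm_zero, mul_zero]
    exact mul_nonneg hr0.le hK0
  · have h1 : 1 ≤ r * ‖x‖ := not_lt.1 hx
    have hsm : ContDiff ℝ (⊤ : ℕ∞) fun y => η (r • y) - 1 :=
      (hηs.comp (contDiff_const_smul r)).sub contDiff_const
    have hleib := norm_iteratedFDeriv_smul_le (𝕜 := ℝ) (N := (⊤ : ℕ∞)) hsm (ψ.smooth _) x (n := m)
      (by exact_mod_cast le_top)
    have hterm : ∀ i, ‖iteratedFDeriv ℝ i (fun y => η (r • y) - 1) x‖ ≤ C i := by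
      intro i
      have hsm' : ContDiff ℝ i fun y => η y - 1 :=
        (hηs.sub contDiff_const).of_le (by exact_mod_cast le_top)
      have := congrFun (iteratedFDeriv_comp_const_smul (𝕜 := ℝ) r hsm') x
      rw [this, norm_smul, norm_pow, Real.norm_of_nonneg hr0.le]
      calc _ ≤ 1 * C i :=
            mul_le_mul (pow_le_one₀ hr0.le hr1) (hC i _) (norm_nonneg _) zero_le_one
        _ = C i := one_mul _
    calc ‖x‖ ^ k * ‖iteratedFDeriv ℝ m (fun y => (η (r • y) - 1) • ψ y) x‖
        ≤ (r * ‖x‖) * ‖x‖ ^ k *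
          ∑ i ∈ Finset.range (m + 1), (m.choose i : ℝ) * C i * ‖iteratedFDeriv ℝ (m - i) ψ x‖ := by
          refine mul_le_mul (le_mul_of_one_le_left (by positivity) h1) (hleib.trans ?_)
            (norm_nonneg _) (by positivity)
          exact Finset.sum_le_sum fun i _ => mul_le_mul_of_nonneg_right
            (mul_le_mul_of_nonneg_left (hterm i) (Nat.cast_nonneg _)) (norm_nonneg _)
      _ = r * ∑ i ∈ Finset.range (m + 1), (m.choose i : ℝ) * C i *
            (‖x‖ ^ (k + 1) * ‖iteratedFDeriv ℝ (m - i) ψ x‖) := by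
          rw [Finset.mul_sum, Finset.mul_sum]
          refine Finset.sum_congr rfl fun i _ => ?_
          ring
      _ ≤ _ := by
          refine mul_le_mul_of_nonneg_left (Finset.sum_le_sum fun i _ => ?_) hr0.le
          exact mul_le_mul_of_nonneg_left (SchwartzMap.le_seminorm ℝ (k + 1) (m - i) ψ x)
            (mul_nonneg (Nat.cast_nonneg _) (hC0 i))

variable [FiniteDimensional ℝ E]

/-- Smooth compactly supported functions are dense in the Schwartz space. -/
lemma SchwartzMap.exists_tendsto_hasCompactSupport (ψ : 𝓢(E, ℂ)) :
    ∃ θ : ℕ → 𝓢(E, ℂ), (∀ n, HasCompactSupport (θ n)) ∧ Tendsto θ atTop (𝓝 ψ) := by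
  obtain ⟨η, hηs, hηc, hη1⟩ : ∃ η : E → ℝ, ContDiff ℝ (⊤ : ℕ∞) η ∧ HasCompactSupport η ∧
      ∀ x, ‖x‖ ≤ 1 → η x = 1 := by
    let B : ContDiffBump (0 : E) := ⟨1, 2, by norm_num, by norm_num⟩
    exact ⟨B, B.contDiff, B.hasCompactSupport, fun x hx =>
      B.one_of_mem_closedBall (mem_closedBall_zero_iff.2 hx)⟩
  have hr0 : ∀ n : ℕ, 0 < 1 / ((n : ℝ) + 1) := fun n => Nat.one_div_pos_of_nat
  have hcut : ∀ n : ℕ, HasCompactSupport fun x => η ((1 / ((n : ℝ) + 1)) • x) • ψ x := by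
    intro n
    have h : HasCompactSupport fun x => η ((1 / ((n : ℝ) + 1)) • x) :=
      hηc.comp_homeomorph (Homeomorph.smulOfNeZero (1 / ((n : ℝ) + 1)) (hr0 n).ne')
    exact h.smul_right (f' := ψ)
  have hcutsm : ∀ n : ℕ, ContDiff ℝ (⊤ : ℕ∞) fun x => η ((1 / ((n : ℝ) + 1)) • x) • ψ x :=
    fun n => (hηs.comp (contDiff_const_smul _)).smul (ψ.smooth _)
  refine ⟨fun n => (hcut n).toSchwartzMap (hcutsm n), fun n => hcut n, ?_⟩
  rw [(schwartz_withSeminorms ℝ E ℂ).tendsto_nhds]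
  rintro ⟨k, m⟩ ε hε
  obtain ⟨K, hK0, hK⟩ := exists_pow_mul_norm_iteratedFDeriv_cutoff_le hηc hηs hη1 ψ k m
  have hbound : ∀ n : ℕ, SchwartzMap.seminorm ℝ k m ((hcut n).toSchwartzMap (hcutsm n) - ψ) ≤
      1 / ((n : ℝ) + 1) * K := by
    intro n
    refine SchwartzMap.seminorm_le_bound ℝ k m _ (mul_nonneg (hr0 n).le hK0) fun x => ?_
    have hfun : (⇑((hcut n).toSchwartzMap (hcutsm n) - ψ) : E → ℂ) =
        fun y => (η ((1 / ((n : ℝ) + 1)) • y) - 1) • ψ y := by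
      ext y
      rw [sub_smul, one_smul]
      rfl
    rw [hfun]
    exact hK _ (hr0 n) (div_le_one_of_le₀ (by linarith [n.cast_nonneg (α := ℝ)]) (by positivity)) x
  have hlim : Tendsto (fun n : ℕ => 1 / ((n : ℝ) + 1) * K) atTop (𝓝 0) := by
    simpa using (tendsto_one_div_add_atTop_nhds_zero_nat (𝕜 := ℝ)).mul_const K
  filter_upwards [hlim.eventually_lt_const hε] with n hn
  exact (hbound n).trans_lt hn

end SchwartzDensity

/-! ### The Laplacian of an `L²` function on the Fourier side -/

section FourierLaplacian

open scoped SchwartzMap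

/-- If `Δ V = f` in the sense of distributions, with `f, V ∈ L²`, then `𝓕 f = -(2π|ξ|)² 𝓕 V`. -/
lemma fourier_ae_eq_of_integral_laplacian_eq {d : ℕ} {f V : L2Space d}
    (h : ∀ ψ : EuclideanSpace ℝ (Fin d) → ℂ, ContDiff ℝ (⊤ : ℕ∞) ψ → HasCompactSupport ψ →
      ∫ x, f x * ψ x = ∫ x, V x * (Δ ψ) x) :
    ∀ᵐ ξ : EuclideanSpace ℝ (Fin d),
      (𝓕 f : L2Space d) ξ = -((2 * Real.pi * ‖ξ‖) ^ 2) • (𝓕 V : L2Space d) ξ := by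
  have hdist : Δ (Lp.toTemperedDistribution V) = Lp.toTemperedDistribution f := by
    -- The hypothesis only sees compactly supported test functions; density and continuity extend it
    -- to Schwartz functions, where the Fourier transform acts.
    ext ψ
    obtain ⟨θ, hθc, hθ⟩ := ψ.exists_tendsto_hasCompactSupport
    have h1 : ∀ n, (Δ (Lp.toTemperedDistribution V)) (θ n) = Lp.toTemperedDistribution f (θ n) := by
      intro n
      rw [TemperedDistribution.laplacian_apply_apply, Lp.toTemperedDistribution_apply,
        Lp.toTemperedDistribution_apply]
      have := h (θ n) ((θ n).smooth _) (hθc n)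
      simp only [smul_eq_mul, SchwartzMap.laplacian_apply]
      simpa only [mul_comm] using this.symm
    have ha := ((Δ (Lp.toTemperedDistribution V)).continuous.tendsto ψ).comp hθ
    have hb := ((Lp.toTemperedDistribution f).continuous.tendsto ψ).comp hθ
    exact tendsto_nhds_unique (ha.congr h1) hb
  have hF : 𝓕 (Lp.toTemperedDistribution f) = ((-(2 * Real.pi) ^ 2 : ℝ) : ℂ) •
      TemperedDistribution.smulLeftCLM ℂ
        (fun x : EuclideanSpace ℝ (Fin d) => Complex.ofReal (‖x‖ ^ 2))
        (𝓕 (Lp.toTemperedDistribution V)) := by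
    rw [← hdist, TemperedDistribution.laplacian_eq_fourierMultiplierCLM,
      TemperedDistribution.fourierMultiplierCLM_apply,
      ← Complex.coe_smul, FourierTransform.fourier_smul,
      FourierTransform.fourier_fourierInv_eq]
  rw [Lp.fourier_toTemperedDistribution_eq, Lp.fourier_toTemperedDistribution_eq] at hF
  have hloc1 : LocallyIntegrable (𝓕 f : L2Space d) := (Lp.memLp _).locallyIntegrable one_le_two
  have hcont : Continuous fun ξ : EuclideanSpace ℝ (Fin d) => (2 * Real.pi * ‖ξ‖) ^ 2 := by
    fun_prop
  -- This product is not known to lie in `L²`, so the two sides are compared as locally integrable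
  -- functions.
  have hloc2 : LocallyIntegrable (fun ξ : EuclideanSpace ℝ (Fin d) =>
      ((2 * Real.pi * ‖ξ‖) ^ 2) • (𝓕 V : L2Space d) ξ) :=
    ((Lp.memLp (𝓕 V : L2Space d)).locallyIntegrable one_le_two).continuous_smul hcont
  have hae := ae_eq_zero_of_integral_contDiff_smul_eq_zero (μ := volume)
    (hloc1.add hloc2) (fun g hg hgc => by
      have hG : HasCompactSupport (Complex.ofRealCLM ∘ g) := hgc.comp_left rfl
      have hG' : ContDiff ℝ (⊤ : ℕ∞) (Complex.ofRealCLM ∘ g) := by fun_prop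
      have := DFunLike.congr_fun hF (hG.toSchwartzMap hG')
      have ht : (fun x : EuclideanSpace ℝ (Fin d) =>
        Complex.ofReal (‖x‖ ^ 2)).HasTemperateGrowth := by fun_prop
      have hi1 := hloc1.integrable_smul_left_of_hasCompactSupport hg.continuous hgc
      have hi2 := hloc2.integrable_smul_left_of_hasCompactSupport hg.continuous hgc
      simp only [Pi.add_apply, smul_add]
      rw [integral_add hi1 hi2]
      have e : ((((-(2 * Real.pi) ^ 2 : ℝ) : ℂ) • TemperedDistribution.smulLeftCLM ℂ
          (fun x : EuclideanSpace ℝ (Fin d) => Complex.ofReal (‖x‖ ^ 2))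
          (Lp.toTemperedDistribution (𝓕 V : L2Space d))) (hG.toSchwartzMap hG')) =
          ((-(2 * Real.pi) ^ 2 : ℝ) : ℂ) • ((Lp.toTemperedDistribution (𝓕 V : L2Space d))
            (SchwartzMap.smulLeftCLM ℂ
              (fun x : EuclideanSpace ℝ (Fin d) => Complex.ofReal (‖x‖ ^ 2))
              (hG.toSchwartzMap hG'))) := rfl
      rw [e, Lp.toTemperedDistribution_apply, Lp.toTemperedDistribution_apply,
        ← integral_smul] at this
      have e1 : ∫ a, g a • (𝓕 f : L2Space d) a =
          ∫ x, (hG.toSchwartzMap hG') x • (𝓕 f : L2Space d) x := by simp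
      rw [e1, this, ← integral_add _ hi2]
      · refine integral_eq_zero_of_ae (ae_of_all _ fun x => ?_)
        simp only [SchwartzMap.smulLeftCLM_apply_apply ht]
        simp
        ring
      · refine hi2.neg.congr (ae_of_all _ fun x => ?_)
        simp only [SchwartzMap.smulLeftCLM_apply_apply ht]
        simp
        ring)
  filter_upwards [hae] with ξ hξ
  rw [neg_smul]
  exact eq_neg_of_add_eq_zero_left hξ

end FourierLaplacian

/-! ### From a weak to a classical second derivative -/

section WeakSecondDerivative

variable {F : Type*} [NormedAddCommGroup F] [NormedSpace ℝ F] [CompleteSpace F] {a : ℝ}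

/-- If `u` is `C¹` up to the boundary with derivative `u₁`, and has the continuous function `b` as
weak second derivative, then `u₁` is differentiable with derivative `b`. -/
lemma hasDerivWithinAt_of_weak_second_deriv {u u₁ b : ℝ → F}
    (hu : ∀ t, a ≤ t → HasDerivWithinAt u (u₁ t) (Ici a) t) (hu₁ : ContinuousOn u₁ (Ici a))
    (hb : ContinuousOn b (Ici a))
    (h : ∀ χ : ℝ → ℝ, ContDiff ℝ (⊤ : ℕ∞) χ → HasCompactSupport χ → tsupport χ ⊆ Ioi a →
      ∫ t, deriv (deriv χ) t • u t = ∫ t, χ t • b t) {t : ℝ} (ht : a ≤ t) :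
    HasDerivWithinAt u₁ (b t) (Ici a) t := by
  -- Freezing `b` at `b a` to the left of `a` gives a continuous function on the line, with a
  -- primitive differentiable also at `a`.
  set β : ℝ → F := fun s => b (max s a) with hβ
  have hβc : Continuous β :=
    hb.comp_continuous (by fun_prop) fun s => le_max_right s a
  have hβb : ∀ s, a ≤ s → β s = b s := fun s hs => by rw [hβ]; simp only; rw [max_eq_left hs]
  set B : ℝ → F := fun t => ∫ s in a..t, β s with hB
  have hBd : ∀ t, HasDerivAt B (β t) t := fun t =>
    intervalIntegral.integral_hasDerivAt_right (hβc.intervalIntegrable _ _)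
      (hβc.stronglyMeasurableAtFilter _ _) hβc.continuousAt
  have hBc : Continuous B := continuous_iff_continuousAt.2 fun t => (hBd t).continuousAt
  have hud : ∀ s ∈ Ioi a, HasDerivAt u (u₁ s) s := fun s hs =>
    (hu s (le_of_lt hs)).hasDerivAt (Ici_mem_nhds hs)
  have hcc : ContinuousOn (fun s => u₁ s - B s) (Ici a) := hu₁.sub hBc.continuousOn
  -- Both `∫ χ' u₁ = -∫ χ'' u` and `∫ χ' B` equal `-∫ χ b`, so `u₁ - B` has zero weak derivative.
  obtain ⟨c₀, hc₀⟩ := exists_eq_const_of_integral_deriv_smul_eq_zero (a := a)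
    (hcc.mono Ioi_subset_Ici_self) (fun χ hχ hχc hχa => by
      have hχ1 : ContDiff ℝ (⊤ : ℕ∞) (deriv χ) := (contDiff_infty_iff_deriv.1 hχ).2
      have hχa' : tsupport (deriv χ) ⊆ Ioi a := tsupport_deriv_subset.trans hχa
      have hu₁' := hu₁.mono Ioi_subset_Ici_self
      have e1 := integral_deriv_smul_eq_neg (hχ1.of_le (by exact_mod_cast le_top)) hχc.deriv hχa'
        hud hu₁'
      have e2 := integral_deriv_smul_eq_neg (a := a) (hχ.of_le (by exact_mod_cast le_top)) hχc hχa
        (fun s _ => hBd s) hβc.continuousOn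
      have e3 : ∫ t, χ t • β t = ∫ t, χ t • b t := by
        rw [← setIntegral_Ioi_eq_integral_of_tsupport_subset hχa,
          ← setIntegral_Ioi_eq_integral_of_tsupport_subset hχa]
        exact setIntegral_congr_fun measurableSet_Ioi fun s hs => by
          rw [hβb s (le_of_lt hs)]
      have hi1 := integrable_smul_of_tsupport_subset isOpen_Ioi hχ1.continuous hχc.deriv hχa' hu₁'
      have hi2 := integrable_smul_of_tsupport_subset isOpen_Ioi hχ1.continuous hχc.deriv hχa'
        (hBc.continuousOn (s := Ioi a))
      simp only [smul_sub]
      rw [integral_sub hi1 hi2, e2, e3, ← h χ hχ hχc hχa, e1]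
      simp)
  have hall : EqOn (fun s => u₁ s - B s) (fun _ => c₀) (Ici a) :=
    EqOn.of_subset_closure (s := Ioi a) hc₀ hcc continuousOn_const Ioi_subset_Ici_self
      (by rw [closure_Ioi])
  have hd := ((hBd t).hasDerivWithinAt (s := Ici a)).add_const c₀
  rw [hβb t ht] at hd
  refine hd.congr (fun s hs => ?_) ?_
  · exact eq_add_of_sub_eq' (hall hs)
  · exact eq_add_of_sub_eq' (hall (mem_Ici.2 ht))

end WeakSecondDerivative

/-! ### Bounded real multipliers on `L²` -/

section Multiplier

variable {d : ℕ}

/-- Multiplication by the bounded real function `m` on `L²`. -/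
def mulOp (m : EuclideanSpace ℝ (Fin d) → ℝ) (hm : MemLp m ∞ volume) :
    L2Space d →L[ℝ] L2Space d :=
  (ContinuousLinearMap.lsmul ℝ ℝ : ℝ →L[ℝ] ℂ →L[ℝ] ℂ).holderL volume ∞ 2 2 hm.toLp

lemma coeFn_mulOp (m : EuclideanSpace ℝ (Fin d) → ℝ) (hm : MemLp m ∞ volume) (f : L2Space d) :
    mulOp m hm f =ᵐ[volume] fun ξ => m ξ • f ξ := by
  filter_upwards [(ContinuousLinearMap.lsmul ℝ ℝ : ℝ →L[ℝ] ℂ →L[ℝ] ℂ).coeFn_holder (r := 2)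
    hm.toLp f, hm.coeFn_toLp] with ξ h1 h2
  rw [h2] at h1
  exact h1

lemma mulOp_mulOp {m n k : EuclideanSpace ℝ (Fin d) → ℝ} (hm : MemLp m ∞ volume)
    (hn : MemLp n ∞ volume) (hk : MemLp k ∞ volume) (h : ∀ ξ, m ξ * n ξ = k ξ) (f : L2Space d) :
    mulOp m hm (mulOp n hn f) = mulOp k hk f := by
  refine Lp.ext ?_
  filter_upwards [coeFn_mulOp m hm (mulOp n hn f), coeFn_mulOp n hn f, coeFn_mulOp k hk f]
    with ξ h1 h2 h3
  rw [h1, h2, h3, smul_smul, h]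

lemma norm_mulOp_le {m : EuclideanSpace ℝ (Fin d) → ℝ} (hm : MemLp m ∞ volume) {c : ℝ}
    (h : ∀ ξ, |m ξ| ≤ c) (f : L2Space d) : ‖mulOp m hm f‖ ≤ c * ‖f‖ := by
  refine Lp.norm_le_mul_norm_of_ae_le_mul ?_
  filter_upwards [coeFn_mulOp m hm f] with ξ h1
  rw [h1, norm_smul]
  exact mul_le_mul_of_nonneg_right (h ξ) (norm_nonneg _)

/-- Real multipliers are symmetric. This provides the hypothesis `hNM` of the energy estimates. -/
lemma inner_mulOp_mulOp {n k : EuclideanSpace ℝ (Fin d) → ℝ}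
    (hn : MemLp n ∞ volume) (hk : MemLp k ∞ volume) (h : ∀ ξ, n ξ ^ 2 = k ξ) (f g : L2Space d) :
    inner ℝ (mulOp n hn f) (mulOp n hn g) = inner ℝ (mulOp k hk f) g := by
  rw [L2.inner_def, L2.inner_def]
  refine integral_congr_ae ?_
  filter_upwards [coeFn_mulOp n hn f, coeFn_mulOp n hn g, coeFn_mulOp k hk f] with ξ h1 h2 h3
  rw [h1, h2, h3, real_inner_smul_left, real_inner_smul_left, real_inner_smul_right, ← h]
  ring

end Multiplier

/-! ### Reduction of the distributional equation to an ordinary differential equation -/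

section Equation

open scoped SchwartzMap

variable {d : ℕ}

/-- As a continuous linear functional, the pairing with `ψ` commutes with `L²`-valued integrals in
time. -/
lemma exists_clm_eq_integral_mul {ψ : EuclideanSpace ℝ (Fin d) → ℂ} (hm : MemLp ψ 2 volume) :
    ∃ L : L2Space d →L[ℝ] ℂ, ∀ f : L2Space d, Integrable (fun x => f x * ψ x) ∧
      L f = ∫ x, f x * ψ x := by
  refine ⟨((ContinuousLinearMap.mul ℝ ℂ).lpPairing volume 2 2).flip hm.toLp, fun f => ⟨?_, ?_⟩⟩
  · exact (Lp.memLp f).integrable_mul hm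
  · rw [ContinuousLinearMap.flip_apply, ContinuousLinearMap.lpPairing_eq_integral]
    refine integral_congr_ae ?_
    filter_upwards [hm.coeFn_toLp] with x hx
    simp [hx]

variable {μ t₀ : ℝ} {v₀ v₁ : L2Space d} {v vt : ℝ → L2Space d}

lemma IsKGSolution.continuousOn (h : IsKGSolution μ t₀ v₀ v₁ v vt) : ContinuousOn v (Ici t₀) :=
  fun t ht => (h.hasDeriv t ht).continuousWithinAt

lemma continuousOn_mass (μ : ℝ) (ht₀ : 0 ≤ t₀) :
    ContinuousOn (fun t : ℝ => μ / (1 + t) ^ 2) (Ici t₀) := by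
  refine continuousOn_const.div (by fun_prop) fun t ht => ?_
  have : 0 < 1 + t := by linarith [mem_Ici.1 ht]
  positivity

lemma deriv_smul_const' {χ : ℝ → ℝ} (hχ : Differentiable ℝ χ) (c : ℂ) :
    deriv (fun s => χ s • c) = fun s => deriv χ s • c :=
  funext fun s => ((hχ s).hasDerivAt.smul_const c).deriv

/-- The time-averaged form of the equation. -/
lemma IsKGSolution.integral_averaged (h : IsKGSolution μ t₀ v₀ v₁ v vt) (ht₀ : 0 ≤ t₀)
    {χ : ℝ → ℝ} (hχ : ContDiff ℝ (⊤ : ℕ∞) χ) (hχc : HasCompactSupport χ)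
    (hχt : tsupport χ ⊆ Ioi t₀)
    {ψ : EuclideanSpace ℝ (Fin d) → ℂ} (hψ : ContDiff ℝ (⊤ : ℕ∞) ψ) (hψc : HasCompactSupport ψ) :
    ∫ x, (∫ t, deriv (deriv χ) t • v t + χ t • (μ / (1 + t) ^ 2) • v t : L2Space d) x * ψ x =
      ∫ x, (∫ t, χ t • v t : L2Space d) x * (Δ ψ) x := by
  have hχ1 : ContDiff ℝ (⊤ : ℕ∞) (deriv χ) := (contDiff_infty_iff_deriv.1 hχ).2
  have hχ2 : ContDiff ℝ (⊤ : ℕ∞) (deriv (deriv χ)) := (contDiff_infty_iff_deriv.1 hχ1).2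
  have hχt2 : tsupport (deriv (deriv χ)) ⊆ Ioi t₀ :=
    tsupport_deriv_subset.trans (tsupport_deriv_subset.trans hχt)
  have hvc := h.continuousOn.mono Ioi_subset_Ici_self
  have hmc := (continuousOn_mass μ ht₀).mono Ioi_subset_Ici_self
  have hi1 := integrable_smul_of_tsupport_subset isOpen_Ioi hχ2.continuous hχc.deriv.deriv hχt2 hvc
  have hi2 := integrable_smul_of_tsupport_subset isOpen_Ioi hχ.continuous hχc hχt (hmc.smul hvc)
  have hi3 := integrable_smul_of_tsupport_subset isOpen_Ioi hχ.continuous hχc hχt hvc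
  have hi12 : Integrable fun t => deriv (deriv χ) t • v t + χ t • (μ / (1 + t) ^ 2) • v t :=
    hi1.add hi2
  have hΔ : MemLp (Δ ψ) 2 volume := by
    have : Δ ψ = ⇑(Δ (hψc.toSchwartzMap hψ) : 𝓢(EuclideanSpace ℝ (Fin d), ℂ)) := by
      ext x
      rw [SchwartzMap.laplacian_apply]
      rfl
    rw [this]
    exact SchwartzMap.memLp _ 2 volume
  obtain ⟨L, hL⟩ := exists_clm_eq_integral_mul (hψ.continuous.memLp_of_hasCompactSupport hψc)
  obtain ⟨L', hL'⟩ := exists_clm_eq_integral_mul hΔ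
  rw [← (hL _).2, ← (hL' _).2, ← L.integral_comp_comm hi12, ← L'.integral_comp_comm hi3,
    ← sub_eq_zero, ← integral_sub (L.integrable_comp hi12) (L'.integrable_comp hi3)]
  have hsub : tsupport (fun p : ℝ × EuclideanSpace ℝ (Fin d) => χ p.1 • ψ p.2) ⊆
      tsupport χ ×ˢ tsupport ψ := by
    refine closure_minimal (fun p hp => ?_) ((isClosed_tsupport _).prod (isClosed_tsupport _))
    rw [Function.mem_support, smul_ne_zero_iff] at hp
    exact ⟨subset_tsupport _ hp.1, subset_tsupport _ hp.2⟩
  have heq := h.equation (fun p => χ p.1 • ψ p.2)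
    ((hχ.comp contDiff_fst).smul (hψ.comp contDiff_snd))
    (HasCompactSupport.of_support_subset_isCompact (hχc.isCompact.prod hψc.isCompact)
      ((subset_tsupport _).trans hsub))
    (hsub.trans (prod_mono hχt (subset_univ _)))
  rw [← heq, ← setIntegral_eq_integral_of_forall_compl_eq_zero (s := Ioi t₀)]
  · refine setIntegral_congr_fun measurableSet_Ioi fun t _ => ?_
    simp only
    have hD : ∀ x, iteratedDeriv 2 (fun s : ℝ => χ s • ψ x) t = deriv (deriv χ) t • ψ x := by
      intro x
      rw [iteratedDeriv_succ, iteratedDeriv_one,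
        deriv_smul_const' (hχ.differentiable (by simp)),
        deriv_smul_const' (hχ1.differentiable (by simp))]
    have hLap : ∀ x, Δ (fun y => χ t • ψ y) x = χ t • Δ ψ x := fun x =>
      InnerProductSpace.laplacian_smul (χ t)
        ((hψ.of_le (WithTop.coe_le_coe.2 (le_top : (2 : ℕ∞) ≤ ⊤))).contDiffAt (x := x))
    simp only [hD, hLap]
    rw [map_add, map_smul, map_smul, map_smul, map_smul, (hL _).2, (hL' _).2, ← integral_smul, ← integral_smul, ← integral_smul, ← integral_smul, ← integral_add,
      ← integral_sub]
    · refine integral_congr_ae (ae_of_all _ fun x => ?_)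
      simp only [Complex.real_smul]
      push_cast
      ring
    · exact ((hL (v t)).1.smul _).add (((hL (v t)).1.smul _).smul _)
    · exact (hL' (v t)).1.smul _
    · exact (hL (v t)).1.smul _
    · exact ((hL (v t)).1.smul _).smul _
  · intro t ht
    rw [image_eq_zero_of_notMem_tsupport (f := χ) fun h => ht (hχt h),
      image_eq_zero_of_notMem_tsupport (f := deriv (deriv χ)) fun h => ht (hχt2 h)]
    simp

/-- The Fourier transform of `L²` followed by multiplication by `m`. -/
def fourierMulOp (m : EuclideanSpace ℝ (Fin d) → ℝ) (hm : MemLp m ∞ volume) :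
    L2Space d →L[ℝ] L2Space d :=
  mulOp m hm ∘L (FourierTransform.fourierCLM ℂ (L2Space d)).restrictScalars ℝ

lemma fourierMulOp_apply (m : EuclideanSpace ℝ (Fin d) → ℝ) (hm : MemLp m ∞ volume)
    (f : L2Space d) : fourierMulOp m hm f = mulOp m hm (𝓕 f) := rfl

/-- Frequency-localized solutions solve an ordinary differential equation in `L²`. -/
lemma IsKGSolution.isModeSolution (h : IsKGSolution μ t₀ v₀ v₁ v vt) (ht₀ : 0 ≤ t₀) {p : ℝ}
    (hp : p * (p - 1) = -μ) {k n : EuclideanSpace ℝ (Fin d) → ℝ} (hk : MemLp k ∞ volume)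
    (hn2 : MemLp (fun ξ => n ξ ^ 2) ∞ volume)
    (hkn : ∀ ξ, n ξ ^ 2 * k ξ = (2 * Real.pi * ‖ξ‖) ^ 2 * k ξ) :
    IsModeSolution p t₀ (mulOp (fun ξ => n ξ ^ 2) hn2) (fun t => fourierMulOp k hk (v t))
      (fun t => fourierMulOp k hk (vt t)) := by
  have hd : ∀ t, t₀ ≤ t → HasDerivWithinAt (fun t => fourierMulOp k hk (v t))
      (fourierMulOp k hk (vt t)) (Ici t₀) t := fun t ht =>
    (fourierMulOp k hk).hasFDerivAt.comp_hasDerivWithinAt t (h.hasDeriv t ht)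
  refine ⟨hd, fun t ht => ?_⟩
  have huc : ContinuousOn (fun t => fourierMulOp k hk (v t)) (Ici t₀) :=
    fun t ht => (hd t ht).continuousWithinAt
  refine hasDerivWithinAt_of_weak_second_deriv hd
    ((fourierMulOp k hk).continuous.comp_continuousOn h.continuous_deriv)
    (b := fun t => -(mulOp (fun ξ => n ξ ^ 2) hn2 (fourierMulOp k hk (v t))) +
      (p * (p - 1) / (1 + t) ^ 2) • fourierMulOp k hk (v t))
    ((((mulOp (fun ξ => n ξ ^ 2) hn2).continuous.comp_continuousOn huc).neg).add
      ((continuousOn_mass _ ht₀).smul huc)) (fun χ hχ hχc hχt => ?_) ht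
  have hχ1 : ContDiff ℝ (⊤ : ℕ∞) (deriv χ) := (contDiff_infty_iff_deriv.1 hχ).2
  have hχ2 : ContDiff ℝ (⊤ : ℕ∞) (deriv (deriv χ)) := (contDiff_infty_iff_deriv.1 hχ1).2
  have hχt2 : tsupport (deriv (deriv χ)) ⊆ Ioi t₀ :=
    tsupport_deriv_subset.trans (tsupport_deriv_subset.trans hχt)
  have hvc := h.continuousOn.mono Ioi_subset_Ici_self
  have hmc := (continuousOn_mass μ ht₀).mono Ioi_subset_Ici_self
  have hi1 := integrable_smul_of_tsupport_subset isOpen_Ioi hχ2.continuous hχc.deriv.deriv hχt2 hvc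
  have hi2 := integrable_smul_of_tsupport_subset isOpen_Ioi hχ.continuous hχc hχt (hmc.smul hvc)
  have hi3 := integrable_smul_of_tsupport_subset isOpen_Ioi hχ.continuous hχc hχt hvc
  have hi12 : Integrable fun t => deriv (deriv χ) t • v t + χ t • (μ / (1 + t) ^ 2) • v t :=
    hi1.add hi2
  set f : L2Space d := ∫ t, deriv (deriv χ) t • v t + χ t • (μ / (1 + t) ^ 2) • v t with hf
  set V : L2Space d := ∫ t, χ t • v t with hV
  have hae := fourier_ae_eq_of_integral_laplacian_eq (f := f) (V := V)
    fun ψ hψ hψc => h.integral_averaged ht₀ hχ hχc hχt hψ hψc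
  set M := mulOp (fun ξ => n ξ ^ 2) hn2 with hM
  set A := fourierMulOp k hk with hA
  -- After multiplication by `k`, the unbounded symbol `|2πξ|²` may be replaced by the bounded `n²`,
  -- by `hkn`.
  have hAV : A f = -M (A V) := by
    refine Lp.ext ?_
    filter_upwards [hae, Lp.coeFn_neg (M (A V)), coeFn_mulOp k hk (𝓕 f),
      coeFn_mulOp _ hn2 (A V), coeFn_mulOp k hk (𝓕 V)] with ξ h1 h2 h3 h4 h5
    rw [h2, Pi.neg_apply, h4, hA, fourierMulOp_apply, fourierMulOp_apply, h5, h3, h1, smul_smul,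
      smul_smul, hkn, ← neg_smul]
    congr 1
    ring
  have e1 : A f = (∫ t, deriv (deriv χ) t • A (v t)) +
      ∫ t, χ t • (μ / (1 + t) ^ 2) • A (v t) := by
    rw [hf, ← A.integral_comp_comm hi12]
    simp only [map_add, map_smul]
    refine integral_add ?_ ?_
    · simpa using A.integrable_comp hi1
    · simpa using A.integrable_comp hi2
  have e2 : M (A V) = ∫ t, χ t • M (A (v t)) := by
    rw [hV, ← A.integral_comp_comm hi3, ← M.integral_comp_comm (A.integrable_comp hi3)]
    simp only [map_smul]
  have hi4 : Integrable fun t => χ t • M (A (v t)) := by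
    simpa using M.integrable_comp (A.integrable_comp hi3)
  have hi5 : Integrable fun t => χ t • (μ / (1 + t) ^ 2) • A (v t) := by
    simpa using A.integrable_comp hi2
  rw [e1, e2] at hAV
  rw [eq_sub_of_add_eq hAV, ← integral_neg, 
    ← integral_sub (f := fun t => -(χ t • M (A (v t)))) hi4.neg hi5]
  refine integral_congr_ae (ae_of_all _ fun t => ?_)
  simp only
  rw [hp, smul_add, smul_neg, neg_div, neg_smul, smul_neg]
  abel

end Equation

/-! ### Frequency splitting and removal of the cutoff -/

section Localization

variable {d : ℕ}

lemma enorm_mulOp (m : EuclideanSpace ℝ (Fin d) → ℝ) (hm : MemLp m ∞ volume) (f : L2Space d) :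
    ‖mulOp m hm f‖ₑ = eLpNorm (fun ξ => m ξ • f ξ) 2 volume := by
  rw [Lp.enorm_def, eLpNorm_congr_ae (coeFn_mulOp m hm f)]

lemma norm_mulOp_le_add {m m₁ m₂ : EuclideanSpace ℝ (Fin d) → ℝ} (hm : MemLp m ∞ volume)
    (hm₁ : MemLp m₁ ∞ volume) (hm₂ : MemLp m₂ ∞ volume) (h : ∀ ξ, |m ξ| ≤ |m₁ ξ + m₂ ξ|)
    (f : L2Space d) : ‖mulOp m hm f‖ ≤ ‖mulOp m₁ hm₁ f‖ + ‖mulOp m₂ hm₂ f‖ := by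
  refine (Lp.norm_le_norm_of_ae_le ?_).trans (norm_add_le (mulOp m₁ hm₁ f) (mulOp m₂ hm₂ f))
  filter_upwards [coeFn_mulOp m hm f, coeFn_mulOp m₁ hm₁ f, coeFn_mulOp m₂ hm₂ f,
    Lp.coeFn_add (mulOp m₁ hm₁ f) (mulOp m₂ hm₂ f)] with ξ h1 h2 h3 h4
  rw [h4, Pi.add_apply, h1, h2, h3, ← add_smul, norm_smul, norm_smul]
  exact mul_le_mul_of_nonneg_right (h ξ) (norm_nonneg _)

/-- Fatou's lemma along balls of integer radius. -/
lemma eLpNorm_le_of_forall_indicator_ball {g : EuclideanSpace ℝ (Fin d) → ℂ} {B : ℝ≥0∞}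
    (hg : AEStronglyMeasurable g volume)
    (h : ∀ ρ : ℕ, eLpNorm ((Metric.ball 0 (ρ : ℝ)).indicator g) 2 volume ≤ B) :
    eLpNorm g 2 volume ≤ B := by
  refine (Lp.eLpNorm_lim_le_liminf_eLpNorm
    (fun ρ : ℕ => hg.indicator (Metric.isOpen_ball (x := 0) (ε := (ρ : ℝ))).measurableSet) g
    (ae_of_all _ fun ξ => ?_)).trans ?_
  · obtain ⟨N, hN⟩ := exists_nat_gt ‖ξ‖
    refine tendsto_const_nhds.congr' ?_
    filter_upwards [eventually_ge_atTop N] with ρ hρ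
    rw [indicator_of_mem]
    rw [mem_ball_zero_iff]
    exact hN.trans_le (by exact_mod_cast hρ)
  · exact liminf_le_of_frequently_le' (Frequently.of_forall h)

/-- The frequency `|2πξ|`, cut off to the set `S`. -/
def cutFreq (S : Set (EuclideanSpace ℝ (Fin d))) : EuclideanSpace ℝ (Fin d) → ℝ :=
  S.indicator fun ξ => 2 * Real.pi * ‖ξ‖

variable {S : Set (EuclideanSpace ℝ (Fin d))} {R : ℝ}

lemma memLp_top_of_measurable_of_abs_le {m : EuclideanSpace ℝ (Fin d) → ℝ} (hm : Measurable m)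
    {c : ℝ} (h : ∀ ξ, |m ξ| ≤ c) : MemLp m ∞ volume :=
  memLp_top_of_bound hm.aestronglyMeasurable c (ae_of_all _ h)

lemma memLp_cutoff (hS : MeasurableSet S) :
    MemLp (S.indicator fun _ => (1 : ℝ)) ∞ volume :=
  memLp_top_of_measurable_of_abs_le (measurable_const.indicator hS) (c := 1) fun ξ => by
    by_cases h : ξ ∈ S <;> simp [h]

lemma measurable_cutFreq (hS : MeasurableSet S) : Measurable (cutFreq S) :=
  Measurable.indicator (by fun_prop) hS

lemma abs_cutFreq_le (hR0 : 0 ≤ R) (hR : ∀ ξ ∈ S, 2 * Real.pi * ‖ξ‖ ≤ R)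
    (ξ : EuclideanSpace ℝ (Fin d)) : |cutFreq S ξ| ≤ R := by
  by_cases h : ξ ∈ S
  · rw [cutFreq, indicator_of_mem h, abs_of_nonneg (by positivity)]
    exact hR ξ h
  · rw [cutFreq, indicator_of_notMem h, abs_zero]
    exact hR0

lemma memLp_cutFreq (hS : MeasurableSet S) (hR0 : 0 ≤ R)
    (hR : ∀ ξ ∈ S, 2 * Real.pi * ‖ξ‖ ≤ R) : MemLp (cutFreq S) ∞ volume :=
  memLp_top_of_measurable_of_abs_le (measurable_cutFreq hS) (abs_cutFreq_le hR0 hR)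

lemma memLp_cutFreq_sq (hS : MeasurableSet S) (hR0 : 0 ≤ R)
    (hR : ∀ ξ ∈ S, 2 * Real.pi * ‖ξ‖ ≤ R) : MemLp (fun ξ => cutFreq S ξ ^ 2) ∞ volume :=
  memLp_top_of_measurable_of_abs_le ((measurable_cutFreq hS).pow_const 2) (c := R ^ 2) fun ξ => by
    rw [abs_pow]
    exact pow_le_pow_left₀ (abs_nonneg _) (abs_cutFreq_le hR0 hR ξ) 2

lemma norm_fourierMulOp_cutoff_le (hS : MeasurableSet S) (f : L2Space d) :
    ‖fourierMulOp _ (memLp_cutoff hS) f‖ ≤ ‖f‖ := by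
  rw [fourierMulOp_apply, ← Lp.norm_fourier_eq f, ← one_mul ‖𝓕 f‖]
  refine norm_mulOp_le _ (fun ξ => ?_) _
  by_cases h : ξ ∈ S <;> simp [h]

lemma modeData_le {H : Type*} [NormedAddCommGroup H] [InnerProductSpace ℝ H] {p t₀ : ℝ}
    {N : H →L[ℝ] H} {u u₁ : ℝ → H} (hp : 1 < p) (ht₀ : 0 ≤ t₀) {a b c : ℝ} (ha : ‖u₁ t₀‖ ≤ a)
    (hb : ‖u t₀‖ ≤ b) (hc : ‖N (u t₀)‖ ≤ c) :
    modeData p t₀ N u u₁ ≤ (1 + t₀) ^ (-p) * ((1 + t₀) * a + (p - 1) * b + (1 + t₀) * c) := by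
  have : 0 ≤ p - 1 := by linarith
  unfold modeData
  gcongr

variable {μ t₀ : ℝ} {v₀ v₁ : L2Space d} {v vt : ℝ → L2Space d}

/-- The low frequency part of a solution in `L²`. -/
lemma IsKGSolution.norm_low_le (h : IsKGSolution μ t₀ v₀ v₁ v vt) (ht₀ : 0 ≤ t₀) {p : ℝ}
    (hp1 : 1 < p) (hp : p * (p - 1) = -μ) (hS : MeasurableSet S)
    (hR : ∀ ξ ∈ S, 2 * Real.pi * ‖ξ‖ ≤ (1 + t₀)⁻¹) {t : ℝ} (ht : t₀ ≤ t) :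
    ‖fourierMulOp _ (memLp_cutoff hS) (v t)‖ ≤
      (1 + t) ^ p * (1 + t₀) ^ (1 - p) * ((p + 1) * ‖v₀‖ + ‖v₁‖) := by
  have hw₀ : 0 < 1 + t₀ := by linarith
  have hw : 0 < 1 + t := by linarith
  have hR0 : 0 ≤ (1 + t₀)⁻¹ := by positivity
  have hk := memLp_cutoff hS
  have hn := memLp_cutFreq hS hR0 hR
  have hn2 := memLp_cutFreq_sq hS hR0 hR
  have hm := h.isModeSolution ht₀ hp hk (n := cutFreq S) hn2 (fun ξ => by
    by_cases hξ : ξ ∈ S <;> simp [cutFreq, hξ])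
  have h0 : ‖fourierMulOp _ hk (v t₀)‖ ≤ ‖v₀‖ := h.initial ▸ norm_fourierMulOp_cutoff_le hS _
  have h1 : ‖fourierMulOp _ hk (vt t₀)‖ ≤ ‖v₁‖ :=
    h.initial_deriv ▸ norm_fourierMulOp_cutoff_le hS _
  have h2 : ‖mulOp _ hn (fourierMulOp _ hk (v t₀))‖ ≤ (1 + t₀)⁻¹ * ‖v₀‖ :=
    (norm_mulOp_le hn (abs_cutFreq_le hR0 hR) _).trans (by gcongr)
  have hb := hm.norm_le hp1 ht₀ (inner_mulOp_mulOp hn hn2 fun _ => rfl) ht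
  have hD := modeData_le hp1 ht₀ (u := fun t => fourierMulOp _ hk (v t))
    (u₁ := fun t => fourierMulOp _ hk (vt t)) h1 h0 h2
  have e : (1 + t₀) ^ (1 - p) = (1 + t₀) ^ (-p) * (1 + t₀) := by
    rw [← Real.rpow_add_one hw₀.ne']; congr 1; ring
  have e2 : (1 + t₀) * ((1 + t₀)⁻¹ * ‖v₀‖) = ‖v₀‖ := mul_inv_cancel_left₀ hw₀.ne' _
  rw [e2] at hD
  refine hb.trans ?_
  rw [mul_assoc ((1 + t) ^ p), e, mul_assoc ((1 + t₀) ^ (-p))]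
  refine mul_le_mul_of_nonneg_left ?_ (by positivity)
  calc _ ≤ (1 + t₀) ^ (-p) * ‖v₀‖ +
        (1 + t₀) ^ (-p) * ((1 + t₀) * ‖v₁‖ + (p - 1) * ‖v₀‖ + ‖v₀‖) := by gcongr
    _ = (1 + t₀) ^ (-p) * (1 * ((p + 1) * ‖v₀‖) + (1 + t₀) * ‖v₁‖) := by ring
    _ ≤ (1 + t₀) ^ (-p) * ((1 + t₀) * ((p + 1) * ‖v₀‖) + (1 + t₀) * ‖v₁‖) := by
        have : 0 ≤ p + 1 := by linarith
        gcongr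
        linarith
    _ = _ := by ring

/-- The high frequency part of a solution in `L²`. -/
lemma IsKGSolution.norm_high_le (h : IsKGSolution μ t₀ v₀ v₁ v vt) (ht₀ : 0 ≤ t₀) {p : ℝ}
    (hp1 : 1 < p) (hp : p * (p - 1) = -μ) (hS : MeasurableSet S) (hR0 : 0 ≤ R)
    (hR : ∀ ξ ∈ S, 2 * Real.pi * ‖ξ‖ ≤ R) (hlow : ∀ ξ ∈ S, (1 + t₀)⁻¹ ≤ 2 * Real.pi * ‖ξ‖)
    {t : ℝ} (ht : t₀ ≤ t) :
    ‖fourierMulOp _ (memLp_cutoff hS) (v t)‖ ≤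
      (1 + t) ^ p * (1 + t₀) ^ (1 - p) * (p * ‖v₀‖ + ‖v₁‖) := by
  have hw₀ : 0 < 1 + t₀ := by linarith
  have hw : 0 < 1 + t := by linarith
  -- The solution is divided by `|2πξ|`, so that its energy-type bound is an `L²` bound for `v`. The
  -- division costs the factor `1 + t₀`.
  have hkb : ∀ ξ, |S.indicator (fun ξ => (2 * Real.pi * ‖ξ‖)⁻¹) ξ| ≤ 1 + t₀ := fun ξ => by
    by_cases hξ : ξ ∈ S
    · rw [indicator_of_mem hξ, abs_of_nonneg (by positivity)]
      exact inv_le_of_inv_le₀ hw₀ (hlow ξ hξ)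
    · rw [indicator_of_notMem hξ, abs_zero]
      exact hw₀.le
  have hk : MemLp (S.indicator fun ξ => (2 * Real.pi * ‖ξ‖)⁻¹) ∞ volume :=
    memLp_top_of_measurable_of_abs_le (Measurable.indicator (by fun_prop) hS) hkb
  have hn := memLp_cutFreq hS hR0 hR
  have hn2 := memLp_cutFreq_sq hS hR0 hR
  have hm := h.isModeSolution ht₀ hp hk (n := cutFreq S) hn2 (fun ξ => by
    by_cases hξ : ξ ∈ S <;> simp [cutFreq, hξ])
  have hNk : ∀ f : L2Space d, mulOp _ hn (fourierMulOp _ hk f) =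
      fourierMulOp _ (memLp_cutoff hS) f := fun f =>
    mulOp_mulOp hn hk (memLp_cutoff hS) (fun ξ => by
      by_cases hξ : ξ ∈ S
      · simp only [cutFreq, indicator_of_mem hξ]
        refine mul_inv_cancel₀ (ne_of_gt ?_)
        exact (inv_pos.2 hw₀).trans_le (hlow ξ hξ)
      · simp [cutFreq, hξ]) _
  have hkn : ∀ f : L2Space d, ‖fourierMulOp _ hk f‖ ≤ (1 + t₀) * ‖f‖ := fun f => by
    rw [← Lp.norm_fourier_eq f]
    exact norm_mulOp_le hk hkb _
  have h0 : ‖fourierMulOp _ hk (v t₀)‖ ≤ (1 + t₀) * ‖v₀‖ := h.initial ▸ hkn _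
  have h1 : ‖fourierMulOp _ hk (vt t₀)‖ ≤ (1 + t₀) * ‖v₁‖ := h.initial_deriv ▸ hkn _
  have h2 : ‖mulOp _ hn (fourierMulOp _ hk (v t₀))‖ ≤ ‖v₀‖ := by
    rw [hNk]
    exact h.initial ▸ norm_fourierMulOp_cutoff_le hS _
  have hb := hm.norm_map_le hp1 ht₀ (inner_mulOp_mulOp hn hn2 fun _ => rfl) ht
  have hD := modeData_le hp1 ht₀ (u := fun t => fourierMulOp _ hk (v t))
    (u₁ := fun t => fourierMulOp _ hk (vt t)) h1 h0 h2
  rw [hNk] at hb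
  have e : (1 + t₀) ^ (1 - p) = (1 + t₀) ^ (-p) * (1 + t₀) := by
    rw [← Real.rpow_add_one hw₀.ne']; congr 1; ring
  have e2 : (1 + t) ^ p = (1 + t) ^ (p - 1) * (1 + t) := by
    rw [← Real.rpow_add_one hw.ne']; congr 1; ring
  calc _ ≤ _ := hb
    _ ≤ (1 + t) ^ (p - 1) * ((1 + t₀) ^ (-p) * ((1 + t₀) * ((1 + t₀) * ‖v₁‖) +
        (p - 1) * ((1 + t₀) * ‖v₀‖) + (1 + t₀) * ‖v₀‖)) := by gcongr
    _ = (1 + t) ^ (p - 1) * (1 + t₀) ^ (1 - p) * (1 * (p * ‖v₀‖) + (1 + t₀) * ‖v₁‖) := by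
        rw [e]; ring
    -- The spare power of `1 + t` between `p - 1` and `p` absorbs the loss `1 + t₀ ≤ 1 + t`.
    _ ≤ (1 + t) ^ (p - 1) * (1 + t₀) ^ (1 - p) * ((1 + t) * (p * ‖v₀‖) + (1 + t) * ‖v₁‖) := by
        gcongr
        linarith
    _ = _ := by rw [e2]; ring

lemma IsKGSolution.norm_cutoff_ball_le (h : IsKGSolution μ t₀ v₀ v₁ v vt) (ht₀ : 0 ≤ t₀) {p : ℝ}
    (hp1 : 1 < p) (hp : p * (p - 1) = -μ) {t : ℝ} (ht : t₀ ≤ t) {ρ : ℝ} (hρ : 0 ≤ ρ)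
    (hball : MeasurableSet (Metric.ball (0 : EuclideanSpace ℝ (Fin d)) ρ)) :
    ‖fourierMulOp _ (memLp_cutoff hball) (v t)‖ ≤
      (2 * p + 1) * (1 + t) ^ p * (1 + t₀) ^ (1 - p) * (‖v₀‖ + ‖v₁‖) := by
  have hw₀ : 0 < 1 + t₀ := by linarith
  have hw : 0 < 1 + t := by linarith
  have hSlm : MeasurableSet {ξ : EuclideanSpace ℝ (Fin d) | 2 * Real.pi * ‖ξ‖ ≤ (1 + t₀)⁻¹} :=
    measurableSet_le (by fun_prop) measurable_const
  have hShm := hball.diff hSlm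
  have hl := h.norm_low_le ht₀ hp1 hp hSlm (fun ξ hξ => hξ) ht
  have hh := h.norm_high_le ht₀ hp1 hp hShm (R := 2 * Real.pi * ρ) (by positivity)
    (fun ξ hξ => mul_le_mul_of_nonneg_left (mem_ball_zero_iff.1 hξ.1).le (by positivity))
    (fun ξ hξ => le_of_not_ge hξ.2) ht
  -- The low set is not intersected with the ball; it suffices that the two cutoffs add up to at
  -- least the cutoff to the ball.
  have hsum := norm_mulOp_le_add (memLp_cutoff hball) (memLp_cutoff hSlm) (memLp_cutoff hShm)
    (fun ξ => by
      by_cases h1 : 2 * Real.pi * ‖ξ‖ ≤ (1 + t₀)⁻¹ <;> by_cases h2 : ‖ξ‖ < ρ <;>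
        simp [h1, h2]) (𝓕 (v t))
  calc _ ≤ _ := hsum
    _ ≤ _ := add_le_add hl hh
    _ = (1 + t) ^ p * (1 + t₀) ^ (1 - p) * ((2 * p + 1) * ‖v₀‖ + 2 * ‖v₁‖) := by ring
    _ ≤ (1 + t) ^ p * (1 + t₀) ^ (1 - p) * ((2 * p + 1) * ‖v₀‖ + (2 * p + 1) * ‖v₁‖) := by
      gcongr
      linarith
    _ = _ := by ring

/-- Control of an `L²` function by its frequency-localized parts. -/
lemma eLpNorm_fourier_le_of_forall_cutoff {f : L2Space d} {K : ℝ} (hK : 0 ≤ K)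
    (h : ∀ (ρ : ℕ) (hball : MeasurableSet (Metric.ball (0 : EuclideanSpace ℝ (Fin d)) ρ)),
      ‖fourierMulOp _ (memLp_cutoff hball) f‖ ≤ K) :
    eLpNorm (𝓕 f : L2Space d) 2 volume ≤ ENNReal.ofReal K := by
  refine eLpNorm_le_of_forall_indicator_ball (Lp.aestronglyMeasurable _) fun ρ => ?_
  have hb := h ρ Metric.isOpen_ball.measurableSet
  rw [fourierMulOp_apply, ← toReal_enorm] at hb
  have := ENNReal.le_ofReal_iff_toReal_le enorm_ne_top hK |>.2 hb
  rw [enorm_mulOp] at this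
  convert this using 2
  ext ξ
  by_cases h2 : ξ ∈ Metric.ball 0 (ρ : ℝ) <;> simp [h2]

/-- Growth of the `L²` norm, uniformly in the initial time. -/
lemma IsKGSolution.norm_le (h : IsKGSolution μ t₀ v₀ v₁ v vt) (ht₀ : 0 ≤ t₀) {p : ℝ}
    (hp1 : 1 < p) (hp : p * (p - 1) = -μ) {t : ℝ} (ht : t₀ ≤ t) :
    ‖v t‖ ≤ (2 * p + 1) * (1 + t) ^ p * (1 + t₀) ^ (1 - p) * (‖v₀‖ + ‖v₁‖) := by
  have hw₀ : 0 < 1 + t₀ := by linarith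
  have hw : 0 < 1 + t := by linarith
  have hK0 : 0 ≤ (2 * p + 1) * (1 + t) ^ p * (1 + t₀) ^ (1 - p) * (‖v₀‖ + ‖v₁‖) := by positivity
  rw [← Lp.norm_fourier_eq, Lp.norm_def]
  exact ENNReal.toReal_le_of_le_ofReal hK0 (eLpNorm_fourier_le_of_forall_cutoff hK0
    fun ρ hball => h.norm_cutoff_ball_le ht₀ hp1 hp ht ρ.cast_nonneg hball)

lemma norm_fourierMulOp_cutFreq_le (hS : MeasurableSet S) (hR0 : 0 ≤ R)
    (hR : ∀ ξ ∈ S, 2 * Real.pi * ‖ξ‖ ≤ R) {f : L2Space d} (hf : hOneNorm f < ⊤) :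
    ‖fourierMulOp _ (memLp_cutFreq hS hR0 hR) f‖ ≤ (hOneNorm f).toReal := by
  rw [fourierMulOp_apply, ← toReal_enorm, enorm_mulOp]
  refine ENNReal.toReal_mono hf.ne (eLpNorm_mono fun ξ => ?_)
  rw [norm_smul, norm_smul]
  refine mul_le_mul_of_nonneg_right ?_ (norm_nonneg _)
  rw [Real.norm_eq_abs, Real.norm_eq_abs, abs_of_nonneg (Real.sqrt_nonneg _)]
  refine Real.le_sqrt_of_sq_le ?_
  rw [sq_abs]
  by_cases hξ : ξ ∈ S
  · simp [cutFreq, hξ]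
  · rw [cutFreq, indicator_of_notMem hξ, zero_pow two_ne_zero]
    positivity

lemma norm_le_toReal_hOneNorm {f : L2Space d} (hf : hOneNorm f < ⊤) :
    ‖f‖ ≤ (hOneNorm f).toReal := by
  rw [← Lp.norm_fourier_eq, Lp.norm_def]
  refine ENNReal.toReal_mono hf.ne (eLpNorm_mono fun ξ => ?_)
  rw [norm_smul, Real.norm_of_nonneg (Real.sqrt_nonneg _)]
  refine le_mul_of_one_le_left (norm_nonneg _) (Real.one_le_sqrt.2 ?_)
  have := sq_nonneg (2 * Real.pi * ‖ξ‖)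
  linarith

/-- Growth of the energy norm of the part of a solution with frequencies in a bounded set. -/
lemma IsKGSolution.norm_energy_le (h : IsKGSolution μ t₀ v₀ v₁ v vt) (ht₀ : 0 ≤ t₀) {p : ℝ}
    (hp1 : 1 < p) (hp : p * (p - 1) = -μ) (hS : MeasurableSet S) (hR0 : 0 ≤ R)
    (hR : ∀ ξ ∈ S, 2 * Real.pi * ‖ξ‖ ≤ R) {t : ℝ} (ht : t₀ ≤ t) :
    ‖fourierMulOp _ (memLp_cutFreq hS hR0 hR) (v t)‖ ≤
        (1 + t) ^ (p - 1) * ((p ^ 2 + p) * ((hOneNorm v₀).toReal + ‖v₁‖)) ∧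
      ‖fourierMulOp _ (memLp_cutoff hS) (vt t)‖ ≤
        (1 + t) ^ (p - 1) * ((p ^ 2 + p) * ((hOneNorm v₀).toReal + ‖v₁‖)) := by
  have hw₀ : 0 < 1 + t₀ := by linarith
  have hw : 0 < 1 + t := by linarith
  have hk := memLp_cutoff hS
  have hn := memLp_cutFreq hS hR0 hR
  have hn2 := memLp_cutFreq_sq hS hR0 hR
  have hv₀ : hOneNorm v₀ < ⊤ := h.initial ▸ h.mem_hOne t₀ le_rfl
  set A := (hOneNorm v₀).toReal with hA
  have hA0 : 0 ≤ A := ENNReal.toReal_nonneg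
  have hm := h.isModeSolution ht₀ hp hk (n := cutFreq S) hn2 (fun ξ => by
    by_cases hξ : ξ ∈ S <;> simp [cutFreq, hξ])
  have hNk : ∀ f : L2Space d, mulOp _ hn (fourierMulOp _ hk f) = fourierMulOp _ hn f := fun f =>
    mulOp_mulOp hn hk hn (fun ξ => by by_cases hξ : ξ ∈ S <;> simp [cutFreq, hξ]) _
  have h0 : ‖fourierMulOp _ hk (v t₀)‖ ≤ A := by
    rw [h.initial]
    exact (norm_fourierMulOp_cutoff_le hS _).trans (norm_le_toReal_hOneNorm hv₀)
  have h1 : ‖fourierMulOp _ hk (vt t₀)‖ ≤ ‖v₁‖ :=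
    h.initial_deriv ▸ norm_fourierMulOp_cutoff_le hS _
  have h2 : ‖mulOp _ hn (fourierMulOp _ hk (v t₀))‖ ≤ A := by
    rw [hNk, h.initial]
    exact norm_fourierMulOp_cutFreq_le hS hR0 hR hv₀
  have hD := modeData_le hp1 ht₀ (u := fun t => fourierMulOp _ hk (v t))
    (u₁ := fun t => fourierMulOp _ hk (vt t)) h1 h0 h2
  have hb1 := hm.norm_map_le hp1 ht₀ (inner_mulOp_mulOp hn hn2 fun _ => rfl) ht
  have hb2 := hm.norm_deriv_le hp1 ht₀ (inner_mulOp_mulOp hn hn2 fun _ => rfl) ht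
  rw [hNk] at hb1
  set D := modeData p t₀ (mulOp (cutFreq S) hn) (fun t => fourierMulOp _ hk (v t))
    (fun t => fourierMulOp _ hk (vt t)) with hDdef
  have hp' : 0 ≤ p - 1 := by linarith
  -- Both weights in the data are at most one because `t₀ ≥ 0` and `p > 1`, so the constant does not
  -- depend on `t₀`.
  have hle1 : (1 + t₀) ^ (-p) ≤ 1 :=
    Real.rpow_le_one_of_one_le_of_nonpos (by linarith) (by linarith)
  have hle2 : (1 + t₀) ^ (-p) * (1 + t₀) ≤ 1 := by
    rw [← Real.rpow_add_one hw₀.ne']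
    exact Real.rpow_le_one_of_one_le_of_nonpos (by linarith) (by linarith)
  have hD' : D ≤ p * A + ‖v₁‖ := by
    calc D ≤ _ := hD
      _ = (1 + t₀) ^ (-p) * (1 + t₀) * ‖v₁‖ + (1 + t₀) ^ (-p) * ((p - 1) * A) +
          (1 + t₀) ^ (-p) * (1 + t₀) * A := by ring
      _ ≤ 1 * ‖v₁‖ + 1 * ((p - 1) * A) + 1 * A := by gcongr
      _ = _ := by ring
  have hv : 0 ≤ ‖v₁‖ := norm_nonneg _
  refine ⟨hb1.trans ?_, hb2.trans ?_⟩
  · refine mul_le_mul_of_nonneg_left (hD'.trans ?_) (by positivity)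
    nlinarith [mul_nonneg (mul_nonneg hp' hp') hA0, mul_nonneg hp' hv, mul_nonneg hp' hA0,
      mul_nonneg (mul_nonneg hp' hp') hv]
  · refine mul_le_mul_of_nonneg_left ?_ (by positivity)
    have e1 : (1 + t₀) ^ (-p) * ‖fourierMulOp _ hk (v t₀)‖ ≤ 1 * A :=
      mul_le_mul hle1 h0 (norm_nonneg _) zero_le_one
    calc _ ≤ p * (p * A + ‖v₁‖) + (p - 1) * (1 * A) := by gcongr
      _ ≤ _ := by nlinarith [mul_nonneg hp' hv, mul_nonneg hp' hA0]

lemma IsKGSolution.hDotOneNorm_add_enorm_le (h : IsKGSolution μ t₀ v₀ v₁ v vt) (ht₀ : 0 ≤ t₀)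
    {p : ℝ} (hp1 : 1 < p) (hp : p * (p - 1) = -μ) {t : ℝ} (ht : t₀ ≤ t) :
    hDotOneNorm (v t) + ‖vt t‖ₑ ≤
      ENNReal.ofReal (2 * (p ^ 2 + p) * (1 + t) ^ (p - 1)) * (hOneNorm v₀ + ‖v₁‖ₑ) := by
  have hw : 0 < 1 + t := by linarith
  have hv₀ : hOneNorm v₀ < ⊤ := h.initial ▸ h.mem_hOne t₀ le_rfl
  set K := (1 + t) ^ (p - 1) * ((p ^ 2 + p) * ((hOneNorm v₀).toReal + ‖v₁‖)) with hK
  have hK0 : 0 ≤ K := by positivity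
  have hball : ∀ ρ : ℕ, MeasurableSet (Metric.ball (0 : EuclideanSpace ℝ (Fin d)) ρ) :=
    fun ρ => Metric.isOpen_ball.measurableSet
  have hb : ∀ ρ : ℕ, _ := fun ρ => h.norm_energy_le ht₀ hp1 hp (hball ρ)
    (R := 2 * Real.pi * ρ) (by positivity) (fun ξ hξ => by
        have := mem_ball_zero_iff.1 hξ
        gcongr) ht
  have h1 : hDotOneNorm (v t) ≤ ENNReal.ofReal K := by
    have hc : Continuous fun ξ : EuclideanSpace ℝ (Fin d) => 2 * Real.pi * ‖ξ‖ := by fun_prop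
    refine eLpNorm_le_of_forall_indicator_ball
      (hc.aestronglyMeasurable.smul (Lp.aestronglyMeasurable _)) fun ρ => ?_
    have hb1 := (hb ρ).1
    rw [fourierMulOp_apply, ← toReal_enorm] at hb1
    have := ENNReal.le_ofReal_iff_toReal_le enorm_ne_top hK0 |>.2 hb1
    rw [enorm_mulOp] at this
    convert this using 2
    ext ξ
    by_cases h2 : ξ ∈ Metric.ball 0 (ρ : ℝ)
    · simp only [cutFreq, indicator_of_mem h2]
    · simp only [cutFreq, indicator_of_notMem h2, zero_smul]
  have h2 : ‖vt t‖ₑ ≤ ENNReal.ofReal K := by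
    have : ‖vt t‖ₑ = ‖(𝓕 (vt t) : L2Space d)‖ₑ := by
      rw [← ofReal_norm, ← ofReal_norm, Lp.norm_fourier_eq]
    rw [this, Lp.enorm_def]
    exact eLpNorm_fourier_le_of_forall_cutoff hK0 fun ρ _ => (hb ρ).2
  have hsum : hOneNorm v₀ + ‖v₁‖ₑ = ENNReal.ofReal ((hOneNorm v₀).toReal + ‖v₁‖) := by
    rw [ENNReal.ofReal_add ENNReal.toReal_nonneg (norm_nonneg _), ENNReal.ofReal_toReal hv₀.ne,
      ofReal_norm]
  rw [hsum, ← ENNReal.ofReal_mul (by positivity)]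
  refine (add_le_add h1 h2).trans ?_
  rw [← ENNReal.ofReal_add hK0 hK0]
  refine ENNReal.ofReal_le_ofReal (le_of_eq ?_)
  rw [hK]
  ring

end Localization

end

/-! ### The two estimates in terms of `ν` -/

theorem mainTheorem8 (d : ℕ) (hd : 0 < d) (μ : ℝ) (hμ : μ < 0) :
    1 / 2 < (kgIndex μ).re ∧
    (∀ t₀ : ℝ, 0 ≤ t₀ → ∃ C : ℝ, 0 < C ∧
      ∀ (v₀ v₁ : L2Space d) (v vt : ℝ → L2Space d), IsKGSolution μ t₀ v₀ v₁ v vt →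
        ∀ t : ℝ, t₀ ≤ t →
          hDotOneNorm (v t) + ‖vt t‖ₑ ≤
            ENNReal.ofReal (C * (1 + t) ^ (-(1 / 2 : ℝ) + (kgIndex μ).re)) *
              (hOneNorm v₀ + ‖v₁‖ₑ)) ∧
    (∃ C : ℝ, 0 < C ∧ ∀ t₀ : ℝ, 0 ≤ t₀ →
      ∀ (v₀ v₁ : L2Space d) (v vt : ℝ → L2Space d), IsKGSolution μ t₀ v₀ v₁ v vt →
        ∀ t : ℝ, t₀ ≤ t →
          ‖v t‖ ≤ C * (1 + t) ^ ((1 / 2 : ℝ) + (kgIndex μ).re) *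
            (1 + t₀) ^ ((1 / 2 : ℝ) - (kgIndex μ).re) * (‖v₀‖ + ‖v₁‖)) := by
  have hν : (kgIndex μ).re = Real.sqrt (1 - 4 * μ) / 2 := by
    rw [kgIndex, if_pos (by linarith), Complex.ofReal_re]
  have hlt : 1 / 2 < (kgIndex μ).re := by
    rw [hν]
    have : 1 < Real.sqrt (1 - 4 * μ) := Real.lt_sqrt_of_sq_lt (by linarith)
    linarith
  obtain ⟨p, hp⟩ : ∃ p, p = 1 / 2 + (kgIndex μ).re := ⟨_, rfl⟩
  have hp1 : 1 < p := by linarith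
  -- Here `p (p - 1) = ν² - 1/4` and `4 ν² = 1 - 4μ`.
  have hpμ : p * (p - 1) = -μ := by
    have := Real.sq_sqrt (show 0 ≤ 1 - 4 * μ by linarith)
    rw [hp, hν]
    linear_combination this / 4
  have e1 : -(1 / 2 : ℝ) + (kgIndex μ).re = p - 1 := by rw [hp]; ring
  have e2 : (1 / 2 : ℝ) - (kgIndex μ).re = 1 - p := by rw [hp]; ring
  refine ⟨hlt, ?_⟩
  rw [e1, e2, ← hp]
  exact ⟨fun t₀ ht₀ => ⟨2 * (p ^ 2 + p), by positivity, fun v₀ v₁ v vt h t ht =>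
    h.hDotOneNorm_add_enorm_le ht₀ hp1 hpμ ht⟩,
    2 * p + 1, by positivity, fun t₀ ht₀ v₀ v₁ v vt h t ht => h.norm_le ht₀ hp1 hpμ ht⟩
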